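/- Let $s>\frac14$. For $L>0$ let $L\mathbb T=\mathbb R/2\pi L\mathbb Z$, with Fourier coefficients $\hat u(\xi)=\frac1{\sqrt{2\pi L}}\int_{L\mathbb T}u(x)e^{-ix\xi}\,dx$, $\xi\in\frac1L\mathbb Z$. Let $H^s=H^s(L\mathbb T)$ be the space of complex-valued $u\in L^2(L\mathbb T)$ with $\hat u(0)=0$ and $\|u\|_{H^s}^2=\sum_{\xi}\langle\xi\rangle^{2s}|\hat u(\xi)|^2<\infty$, where $\langle\xi\rangle=(1+\xi^2)^{1/2}$. Let $W=(1-\partial_x^2)^{-1}\partial_x$ be the Fourier multiplier by $i\omega(\xi)$, $\omega(\xi)=\frac{\xi}{1+\xi^2}$, and $S(t)=e^{-tW}$. For $a\in H^s$ set $\Psi_{\varepsilon,L,0}(t)(a)=S(t)a$ and, for $n\ge 0$, $$\Psi_{\varepsilon,L,n+1}(t)(a)=-\varepsilon\int_0^t S(t-\tau)\,W\Big[\sum_{n_1+n_2=n}\Psi_{\varepsilon,L,n_1}(\tau)(a)\,\Psi_{\varepsilon,L,n_2}(\tau)(a)\Big]d\tau .$$ There is a constant $C_s>0$, depending only on $s$,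 such that the following holds for all $L\ge1$, all $D\ge1$ and all $0<\varepsilon\le\frac{1}{C_sD^2L^5}$. Set $T_0(L,D)=\frac1{C_sD^2L^2}$ and $I=[-\varepsilon^{-2}T_0(L,D),\,\varepsilon^{-2}T_0(L,D)]$. The Cauchy problem $$\partial_tu+Wu+\varepsilon W(u^2)=0,\qquad u(0)=a,$$ is well-posed in $\mathcal C(I,H^s)$ for initial data $a\in H^s$ with $\|a\|_{H^s}\le D\sqrt L$. That is: for each such $a$ there is exactly one $u\in\mathcal C(I,H^s)$ that solves it on $I$ (with the time derivative taken in $H^s$); writing $u(t)=\Psi_{\varepsilon,L}(t)(a)$, we have $\|\Psi_{\varepsilon,L}(t)(a)-\Psi_{\varepsilon,L}(t)(b)\|_{H^s}\le2\|a-b\|_{H^s}$ for all $t\in I$ and all such $a,b$; and the solution is real-valued if $a$ is. Moreover, for all such $a$ and all $t\in I$, the flow is given by the series $$\Psi_{\varepsilon,L}(t)(a)=\sum_{n\ge0}\Psi_{\varepsilon,L,n}(t)(a),$$ which converges in $H^s$, and $$\sup_{t\in I}\|\Psi_{\varepsilon,L,n}(t)(a)\|_{H^s}\le2^{-n}D\sqrt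 L\qquad\text{for all }n\ge0 .$$ -/

import Mathlib

open MeasureTheory

noncomputable section

namespace BBM

instance torusLengthPos (L : ℝ) [hL : Fact (0 < L)] : Fact (0 < 2 * Real.pi * L) :=
  ⟨mul_pos Real.two_pi_pos hL.out⟩

/-- The torus `L𝕋`, of length `2πL`; its frequencies are the `k / L` with `k : ℤ`. -/
abbrev Torus (L : ℝ) : Type := AddCircle (2 * Real.pi * L)

/-- `L²(L𝕋)`, for complex-valued functions. (The reference measure is normalised to have mass one;
this measure is only used to say what a square integrable function is.) -/
abbrev L2 (L : ℝ) [Fact (0 < L)] : Type :=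
  Lp ℂ 2 (AddCircle.haarAddCircle (T := 2 * Real.pi * L))

/-- The Fourier coefficient at the frequency `ξ = k / L`:
`û(ξ) = (2πL)^{-1/2} ∫_{L𝕋} u(x) e^{-ixξ} dx`. -/
def hat (L : ℝ) (u : Torus L → ℂ) (k : ℤ) : ℂ :=
  ((1 / Real.sqrt (2 * Real.pi * L) : ℝ) : ℂ) *
    ∫ x in (0 : ℝ)..(2 * Real.pi * L),
      u (x : Torus L) * Complex.exp (-(Complex.I * (x : ℂ) * ((k / L : ℝ) : ℂ)))

/-- The Japanese bracket `⟨ξ⟩ = (1 + ξ²)^{1/2}`. -/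
def bracket (ξ : ℝ) : ℝ := Real.sqrt (1 + ξ ^ 2)

/-- The dispersion relation `ω(ξ) = ξ / (1 + ξ²)`. -/
def omega (ξ : ℝ) : ℝ := ξ / (1 + ξ ^ 2)

section Basic

set_option linter.unusedSectionVars false

variable {L : ℝ} [hL : Fact (0 < L)]

/-- `hat` is Mathlib's `fourierCoeff` in another normalisation. -/
theorem hat_eq (u : Torus L → ℂ) (k : ℤ) :
    hat L u k = (Real.sqrt (2 * Real.pi * L) : ℂ) * fourierCoeff u k := by
  have hpos : 0 < 2 * Real.pi * L := (torusLengthPos L).out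
  have hpi : (Real.pi : ℂ) ≠ 0 := by exact_mod_cast Real.pi_ne_zero
  have hLne : (L : ℂ) ≠ 0 := by exact_mod_cast hL.out.ne'
  rw [fourierCoeff_eq_intervalIntegral u k 0, zero_add, hat, Complex.real_smul, ← mul_assoc]
  congr 1
  · rw [← Complex.ofReal_mul]
    congr 1
    have h := Real.sq_sqrt hpos.le
    have h' : Real.sqrt (2 * Real.pi * L) ≠ 0 := (Real.sqrt_pos.2 hpos).ne'
    rw [mul_one_div, div_eq_div_iff h' hpos.ne', one_mul, ← sq, h]
  · refine intervalIntegral.integral_congr fun x _ => ?_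
    simp only [fourier_coe_apply, smul_eq_mul]
    rw [mul_comm]
    congr 2
    push_cast
    field_simp

theorem integrable_coe (f : L2 L) :
    Integrable (f : Torus L → ℂ) (AddCircle.haarAddCircle (T := 2 * Real.pi * L)) :=
  (Lp.memLp f).integrable (by norm_num)

theorem hat_add (f g : L2 L) (k : ℤ) :
    hat L ((f + g : L2 L) : Torus L → ℂ) k = hat L f k + hat L g k := by
  rw [hat_eq, hat_eq, hat_eq, ← mul_add, fourierCoeff_congr_ae (Lp.coeFn_add f g),
    fourierCoeff.add (integrable_coe f) (integrable_coe g)]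
  rfl

theorem hat_smul (c : ℂ) (f : L2 L) (k : ℤ) :
    hat L ((c • f : L2 L) : Torus L → ℂ) k = c * hat L f k := by
  rw [hat_eq, hat_eq, fourierCoeff_congr_ae (Lp.coeFn_smul c f), fourierCoeff.const_smul]
  simp only [smul_eq_mul]
  ring

theorem hat_zero (k : ℤ) : hat L ((0 : L2 L) : Torus L → ℂ) k = 0 := by
  simpa using hat_smul (L := L) 0 0 k

theorem eq_zero_of_hat (f : L2 L) (h : ∀ k, hat L f k = 0) : f = 0 := by
  apply fourierBasis.repr.injective
  rw [map_zero]
  ext k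
  have hk := h k
  have h' : ((Real.sqrt (2 * Real.pi * L) : ℝ) : ℂ) ≠ 0 := by
    exact_mod_cast (Real.sqrt_pos.2 (torusLengthPos L).out).ne'
  rw [hat_eq] at hk
  rw [fourierBasis_repr]
  simpa using (mul_eq_zero.1 hk).resolve_left h'

/-- Every square summable sequence is the sequence of Fourier coefficients of a function. -/
theorem exists_hat_eq (c : ℤ → ℂ) (hc : Memℓp c 2) : ∃ f : L2 L, ∀ k, hat L f k = c k := by
  have h' : ((Real.sqrt (2 * Real.pi * L) : ℝ) : ℂ) ≠ 0 := by
    exact_mod_cast (Real.sqrt_pos.2 (torusLengthPos L).out).ne'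
  let q : lp (fun _ : ℤ => ℂ) 2 := ⟨c, hc⟩
  refine ⟨((Real.sqrt (2 * Real.pi * L) : ℝ) : ℂ)⁻¹ • fourierBasis.repr.symm q, fun k => ?_⟩
  rw [hat_smul, hat_eq, ← fourierBasis_repr, LinearIsometryEquiv.apply_symm_apply]
  exact inv_mul_cancel_left₀ h' (c k)

/-- The condition `∑_ξ ⟨ξ⟩^{2s} |û(ξ)|² < ∞`, as membership in `ℓ²`. -/
theorem memlp_iff (s : ℝ) (f : Torus L → ℂ) :
    Memℓp (fun k : ℤ => ((bracket (k / L) ^ s : ℝ) : ℂ) * hat L f k) 2 ↔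
      Summable fun k : ℤ => bracket (k / L) ^ (2 * s) * ‖hat L f k‖ ^ 2 := by
  rw [memℓp_gen_iff (by norm_num)]
  refine summable_congr fun k => ?_
  have hb : 0 ≤ bracket (k / L) := Real.sqrt_nonneg _
  rw [norm_mul, Complex.norm_real, Real.norm_of_nonneg (Real.rpow_nonneg hb s)]
  norm_num
  rw [mul_pow, ← Real.rpow_natCast, ← Real.rpow_mul hb, mul_comm s]
  norm_num

end Basic

/-- The functions `u ∈ L²(L𝕋)` with `û(0) = 0` and `∑_ξ ⟨ξ⟩^{2s} |û(ξ)|² < ∞`. -/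
def sobolevSubmodule (L : ℝ) [Fact (0 < L)] (s : ℝ) : Submodule ℂ (L2 L) where
  carrier := {u | hat L u 0 = 0 ∧
    Summable fun k : ℤ => bracket (k / L) ^ (2 * s) * ‖hat L u k‖ ^ 2}
  zero_mem' := by
    refine ⟨hat_zero 0, ?_⟩
    refine summable_zero.congr fun k => ?_
    rw [hat_zero, norm_zero]
    ring
  add_mem' := by
    rintro f g ⟨hf0, hf⟩ ⟨hg0, hg⟩
    refine ⟨by rw [hat_add, hf0, hg0, add_zero], ?_⟩
    rw [← memlp_iff] at *
    convert hf.add hg using 1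
    funext k
    rw [Pi.add_apply, hat_add, mul_add]
  smul_mem' := by
    rintro c f ⟨hf0, hf⟩
    refine ⟨by rw [hat_smul, hf0, mul_zero], ?_⟩
    rw [← memlp_iff] at *
    convert hf.const_smul c using 1
    funext k
    rw [Pi.smul_apply, hat_smul, smul_eq_mul]
    ring

/-- The Sobolev space `H^s(L𝕋)` (of functions with mean zero). It is a type of its own, since its
norm is not the one of `L²`. -/
def Hs (L : ℝ) [Fact (0 < L)] (s : ℝ) : Type := sobolevSubmodule L s

section Sobolev

variable {L : ℝ} [hL : Fact (0 < L)] {s : ℝ}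

instance : AddCommGroup (Hs L s) := inferInstanceAs (AddCommGroup (sobolevSubmodule L s))

instance : Module ℂ (Hs L s) := inferInstanceAs (Module ℂ (sobolevSubmodule L s))

/-- The element of `L²(L𝕋)` underlying an element of `H^s(L𝕋)`. -/
def Hs.toL2 (u : Hs L s) : L2 L := (show sobolevSubmodule L s from u).1

instance : CoeFun (Hs L s) fun _ => Torus L → ℂ := ⟨fun u => (u.toL2 : Torus L → ℂ)⟩

theorem Hs.hat_add (u v : Hs L s) (k : ℤ) : hat L (u + v : Hs L s) k = hat L u k + hat L v k :=
  BBM.hat_add u.toL2 v.toL2 k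

theorem Hs.hat_smul (c : ℂ) (u : Hs L s) (k : ℤ) : hat L (c • u : Hs L s) k = c * hat L u k :=
  BBM.hat_smul c u.toL2 k

theorem Hs.hat_zero (k : ℤ) : hat L (0 : Hs L s) k = 0 := BBM.hat_zero k

theorem Hs.ext_hat {u v : Hs L s} (h : ∀ k, hat L u k = hat L v k) : u = v := by
  rw [← sub_eq_zero]
  refine Subtype.ext (eq_zero_of_hat _ fun k => ?_)
  have h1 := Hs.hat_add u ((-1 : ℂ) • v) k
  rw [Hs.hat_smul, h k] at h1
  have h2 : u - v = u + (-1 : ℂ) • v := by rw [neg_one_smul, sub_eq_add_neg]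
  change hat L (u - v : Hs L s) k = 0
  rw [h2, h1]
  ring

/-- The weighted sequence `(⟨ξ⟩^s û(ξ))_ξ` in `ℓ²`. -/
def Hs.toSeq : Hs L s →ₗ[ℂ] lp (fun _ : ℤ => ℂ) 2 where
  toFun u := ⟨fun k : ℤ => ((bracket (k / L) ^ s : ℝ) : ℂ) * hat L u k,
    (memlp_iff s (u : Torus L → ℂ)).2 (show sobolevSubmodule L s from u).2.2⟩
  map_add' u v := by
    ext k
    change _ * hat L (u + v : Hs L s) k = _ * hat L u k + _ * hat L v k
    rw [Hs.hat_add, mul_add]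
  map_smul' c u := by
    ext k
    change _ * hat L (c • u : Hs L s) k = c * (_ * hat L u k)
    rw [Hs.hat_smul]
    ring

theorem Hs.norm_toSeq (u : Hs L s) :
    ‖Hs.toSeq u‖ = Real.sqrt (∑' k : ℤ, bracket (k / L) ^ (2 * s) * ‖hat L u k‖ ^ 2) := by
  rw [lp.norm_eq_tsum_rpow (by norm_num), Real.sqrt_eq_rpow]
  norm_num
  congr 1
  refine tsum_congr fun k => ?_
  have hb : 0 ≤ bracket (k / L) := Real.sqrt_nonneg _
  change ‖((bracket (k / L) ^ s : ℝ) : ℂ) * hat L u k‖ ^ 2 = _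
  rw [norm_mul, Complex.norm_real, Real.norm_of_nonneg (Real.rpow_nonneg hb s),
    mul_pow, ← Real.rpow_natCast, ← Real.rpow_mul hb, mul_comm s]
  norm_num

/-- `‖u‖_{H^s}² = ∑_ξ ⟨ξ⟩^{2s} |û(ξ)|²`; the term of `ξ = 0` vanishes. -/
instance : NormedAddCommGroup (Hs L s) :=
  AddGroupNorm.toNormedAddCommGroup
    { toFun := fun u => Real.sqrt (∑' k : ℤ, bracket (k / L) ^ (2 * s) * ‖hat L u k‖ ^ 2)
      map_zero' := by rw [← Hs.norm_toSeq, map_zero, norm_zero]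
      add_le' := fun u v => by
        rw [← Hs.norm_toSeq, ← Hs.norm_toSeq, ← Hs.norm_toSeq, map_add]
        exact norm_add_le _ _
      neg' := fun u => by rw [← Hs.norm_toSeq, ← Hs.norm_toSeq, map_neg, norm_neg]
      eq_zero_of_map_eq_zero' := fun u hu => by
        rw [← Hs.norm_toSeq, norm_eq_zero] at hu
        refine Hs.ext_hat fun k => ?_
        have hk : ((bracket (k / L) ^ s : ℝ) : ℂ) * hat L u k = 0 := by
          exact congrArg (fun q : lp (fun _ : ℤ => ℂ) 2 => q k) hu
        have hb : 0 < bracket (k / L) := Real.sqrt_pos.2 (by positivity)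
        rw [Hs.hat_zero]
        refine (mul_eq_zero.1 hk).resolve_left ?_
        exact_mod_cast (Real.rpow_pos_of_pos hb s).ne' }

theorem Hs.norm_def (u : Hs L s) :
    ‖u‖ = Real.sqrt (∑' k : ℤ, bracket (k / L) ^ (2 * s) * ‖hat L u k‖ ^ 2) := rfl

instance : NormedSpace ℂ (Hs L s) where
  norm_smul_le c u := by
    rw [Hs.norm_def, Hs.norm_def, ← Hs.norm_toSeq, ← Hs.norm_toSeq, map_smul]
    exact (norm_smul c _).le

/-- `H^s` is complete for `s ≥ 0`, so that integrals with values in it make sense. -/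
theorem Hs.completeSpace (hs : 0 ≤ s) : CompleteSpace (Hs L s) := by
  have hiso : Isometry (Hs.toSeq (L := L) (s := s)) :=
    AddMonoidHomClass.isometry_of_norm _ fun u => by rw [Hs.norm_toSeq, Hs.norm_def]
  rw [completeSpace_iff_isComplete_range hiso.isUniformInducing]
  apply IsClosed.isComplete
  have hr : Set.range (Hs.toSeq (L := L) (s := s)) =
      {q : lp (fun _ : ℤ => ℂ) 2 | q 0 = 0} := by
    ext q
    constructor
    · rintro ⟨u, rfl⟩
      change ((bracket ((0 : ℤ) / L) ^ s : ℝ) : ℂ) * hat L u 0 = 0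
      have h0 : hat L u 0 = 0 := (show sobolevSubmodule L s from u).2.1
      rw [h0, mul_zero]
    · intro hq
      have hone : ∀ k : ℤ, 1 ≤ bracket (k / L) ^ s := fun k =>
        Real.one_le_rpow (Real.one_le_sqrt.2 (by nlinarith [sq_nonneg ((k : ℝ) / L)])) hs
      have h1 : Memℓp (fun k : ℤ => ((bracket (k / L) ^ s : ℝ) : ℂ)⁻¹ * q k) 2 := by
        have hq2 := (memℓp_gen_iff (p := 2) (by norm_num)).1 (lp.memℓp q)
        rw [memℓp_gen_iff (by norm_num)]
        refine Summable.of_nonneg_of_le (fun k => Real.rpow_nonneg (norm_nonneg _) _)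
          (fun k => ?_) hq2
        refine Real.rpow_le_rpow (norm_nonneg _) ?_ (by norm_num)
        rw [norm_mul, norm_inv, Complex.norm_real,
          Real.norm_of_nonneg (zero_le_one.trans (hone k))]
        exact mul_le_of_le_one_left (norm_nonneg _) (inv_le_one_of_one_le₀ (hone k))
      obtain ⟨f, hf⟩ := exists_hat_eq (L := L) _ h1
      have hfq : (fun k : ℤ => ((bracket (k / L) ^ s : ℝ) : ℂ) * hat L f k) = q := by
        funext k
        rw [hf]
        refine mul_inv_cancel_left₀ ?_ _
        exact_mod_cast (zero_lt_one.trans_le (hone k)).ne'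
      refine ⟨(⟨f, ?_, ?_⟩ : sobolevSubmodule L s), ?_⟩
      · rw [hf, show q 0 = 0 from hq, mul_zero]
      · rw [← memlp_iff, hfq]
        exact lp.memℓp q
      · ext k
        exact congrFun hfq k
  rw [hr]
  exact isClosed_eq
    ((lp.uniformContinuous_coe (p := 2)).continuous.comp' continuous_id |> fun h =>
      (continuous_apply (0 : ℤ)).comp h) continuous_const

end Sobolev

section Equation

variable (L : ℝ) [hL : Fact (0 < L)] (s : ℝ)

open Classical in
/-- The Fourier multiplier of symbol `m` applied to an integrable function `f` on `L𝕋`: the element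
of `H^s` whose Fourier coefficients are the `m(ξ) f̂(ξ)`. It is unique if it exists, and it exists
for all the symbols and functions used below. -/
def multiplier (m : ℝ → ℂ) (f : Torus L → ℂ) : Hs L s :=
  if h : ∃ v : Hs L s, ∀ k : ℤ, hat L v k = m (k / L) * hat L f k then h.choose else 0

/-- `W = (1 - ∂ₓ²)⁻¹ ∂ₓ`, the Fourier multiplier by `i ω(ξ)`. -/
def W (f : Torus L → ℂ) : Hs L s :=
  multiplier L s (fun ξ => Complex.I * (omega ξ : ℂ)) f

/-- The linear group `S(t) = e^{-tW}`, the Fourier multiplier by `e^{-itω(ξ)}`. -/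
def S (t : ℝ) (u : Hs L s) : Hs L s :=
  multiplier L s (fun ξ => Complex.exp (-(Complex.I * (t : ℂ) * (omega ξ : ℂ)))) u

variable (ε : ℝ)

/-- The terms of the Dyson series: `Ψ₀(t)(a) = S(t) a` and
`Ψ_{n+1}(t)(a) = -ε ∫₀ᵗ S(t-τ) W [∑_{n₁+n₂=n} Ψ_{n₁}(τ)(a) Ψ_{n₂}(τ)(a)] dτ`,
where the integral is an integral in `H^s`. -/
def dysonTerm (a : Hs L s) : ℕ → ℝ → Hs L s
  | 0 => fun t => S L s t a
  | n + 1 => fun t => -((ε : ℂ) • ∫ τ in (0 : ℝ)..t, S L s (t - τ)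
      (W L s fun x => ∑ j : Fin (n + 1), dysonTerm a j τ x * dysonTerm a (n - j) τ x))
  termination_by n => n
  decreasing_by all_goals omega

theorem dysonTerm_zero (a : Hs L s) (t : ℝ) : dysonTerm L s ε a 0 t = S L s t a := by
  rw [dysonTerm]

theorem dysonTerm_succ (a : Hs L s) (n : ℕ) (t : ℝ) :
    dysonTerm L s ε a (n + 1) t = -((ε : ℂ) • ∫ τ in (0 : ℝ)..t, S L s (t - τ)
      (W L s fun x => ∑ p ∈ Finset.HasAntidiagonal.antidiagonal n,
        dysonTerm L s ε a p.1 τ x * dysonTerm L s ε a p.2 τ x)) := by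
  rw [dysonTerm]
  simp only [Finset.Nat.sum_antidiagonal_eq_sum_range_succ_mk, Finset.sum_range]

/-- `u ∈ C([-T,T], H^s)` solves `∂ₜu + W u + ε W(u²) = 0`, `u(0) = a` on `[-T, T]`; the time
derivative is taken in `H^s`, which contains `W u` and `W(u²)`. -/
def IsSolution (T : ℝ) (a : Hs L s) (u : ℝ → Hs L s) : Prop :=
  ContinuousOn u (Set.Icc (-T) T) ∧ u 0 = a ∧
    ∀ t ∈ Set.Icc (-T) T, HasDerivWithinAt u
      (-(W L s (u t) + (ε : ℂ) • W L s fun x => u t x ^ 2)) (Set.Icc (-T) T) t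

end Equation

end BBM

end

/-! On `H^s` both `W` and `N(u, v) = W(uv)` are bounded, so the equation is an ODE with a locally
Lipschitz vector field, and uniqueness is soft. The difficulty is the length `ε⁻² T₀` of the
interval: on it the quadratic term has to act like a cubic one. This is achieved by a normal form,
regularised by a parameter `λ = 1/T`.

The resonance function `Ω(x, y) = ω(x+y) - ω(x) - ω(y)` factors explicitly and vanishes only when
`x`, `y` or `x + y` does. Let `B` be the bilinear multiplier of symbol `iω(x+y) / (iΩ + λ)`. Then `N
= λB + WB - B(W·, ·) - B(·, W·)`, so for curves with `p' = -Wp + P` and `q' = -Wq + Q`, `N(p, q) =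
(∂ₜ + W) B(p, q) + λB(p, q) - B(P, q) - B(p, Q)`. In Duhamel's integral over a time at most `T =
1/λ`, the first two terms cost three times the supremum of `‖B(p, q)‖`, without a factor `T`. For
the terms of the Dyson series `P` and `Q` carry a factor `ε`, so the last two terms are cubic and
cost `ε² T` altogether (`NormalForm.norm_integral_le`).

Two estimates carry the argument. First, without `λ` the symbol of `B` is merely bounded, by `2L²`,
which would suit an algebra `H^s`, `s > 1/2`. With `λ` it gains half a derivative at high
frequencies at the price `√T`, and `s > 1/4` suffices (`norm_sq_nfSymbol_le`). The price is
affordable, since `ε √T D √L` is small. Secondly, in `B(N(p, q), r)` the factor `ω` of the inner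
product yields a bound without any `T` (`norm_sq_nfSymbol_mul_omega_le`). A Schur test
(`kernel_bound`) turns these symbol bounds into operator bounds.

The terms of the series are controlled through the partial sums of `2ⁿ sup ‖uₙ‖`. The recursion is
quadratic and cubic in the sequence, and Cauchy products are submultiplicative for such sums, so
smallness closes an induction. The same induction for the difference of two series is linear in the
difference and gives the Lipschitz constant `2`. -/

namespace BBM

/-! ### The group of a bounded operator and Duhamel's formula -/

section Flow

variable {E : Type*} [NormedAddCommGroup E] [NormedSpace ℝ E]

/-- The group `e^{-tW}` generated by a bounded operator. -/
noncomputable def flow (W : E →L[ℝ] E) (t : ℝ) : E →L[ℝ] E := NormedSpace.exp (t • (-W))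

theorem flow_zero (W : E →L[ℝ] E) : flow W 0 = 1 := by
  rw [flow, zero_smul, NormedSpace.exp_zero]

variable [CompleteSpace E]

theorem hasDerivAt_flow (W : E →L[ℝ] E) (t : ℝ) : HasDerivAt (flow W) (-(W * flow W t)) t := by
  have h := hasDerivAt_exp_smul_const' (𝕂 := ℝ) (-W) t
  rwa [neg_mul] at h

theorem hasDerivAt_flow' (W : E →L[ℝ] E) (t : ℝ) : HasDerivAt (flow W) (-(flow W t * W)) t := by
  have h := hasDerivAt_exp_smul_const (𝕂 := ℝ) (-W) t
  rwa [mul_neg] at h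

theorem continuous_flow (W : E →L[ℝ] E) : Continuous (flow W) :=
  continuous_iff_continuousAt.2 fun t => (hasDerivAt_flow W t).continuousAt

theorem flow_add (W : E →L[ℝ] E) (t r : ℝ) : flow W (t + r) = flow W t * flow W r := by
  let _ : NormedAlgebra ℚ (E →L[ℝ] E) := NormedAlgebra.restrictScalars ℚ ℝ (E →L[ℝ] E)
  rw [flow, add_smul]
  exact NormedSpace.exp_add_of_commute (((Commute.refl (-W)).smul_left t).smul_right r)

theorem continuous_flow_apply (W : E →L[ℝ] E) {f : ℝ → E} (hf : Continuous f) (t : ℝ) :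
    Continuous fun τ => flow W (t - τ) (f τ) :=
  ((continuous_flow W).comp (continuous_const.sub continuous_id)).clm_apply hf

/-- Duhamel's formula. -/
theorem integral_flow_eq (W : E →L[ℝ] E) {g H : ℝ → E} (hH : Continuous H)
    (hg : ∀ t, HasDerivAt g (-(W (g t)) + H t) t) (t : ℝ) :
    ∫ τ in (0 : ℝ)..t, flow W (t - τ) (H τ) = g t - flow W t (g 0) := by
  have hd : ∀ τ : ℝ, HasDerivAt (fun τ => flow W (t - τ) (g τ)) (flow W (t - τ) (H τ)) τ := by
    intro τ
    have h1 : HasDerivAt (fun τ => flow W (t - τ)) (flow W (t - τ) * W) τ := by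
      have := (hasDerivAt_flow' W (t - τ)).scomp τ ((hasDerivAt_id τ).const_sub t)
      simpa [Function.comp_def] using this
    have h2 := h1.clm_apply (hg τ)
    convert h2 using 1
    simp
  rw [intervalIntegral.integral_eq_sub_of_hasDerivAt (fun τ _ => hd τ)
    ((continuous_flow_apply W hH t).intervalIntegrable _ _)]
  simp [flow_zero]

/-- The group law takes `flow W t` out of the integral, which leaves a product whose second factor
is a primitive of a continuous curve. -/
theorem hasDerivAt_integral_flow (W : E →L[ℝ] E) {H : ℝ → E} (hH : Continuous H) (t : ℝ) :
    HasDerivAt (fun t => ∫ τ in (0 : ℝ)..t, flow W (t - τ) (H τ))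
      (-(W (∫ τ in (0 : ℝ)..t, flow W (t - τ) (H τ))) + H t) t := by
  have hc : Continuous fun τ => flow W (-τ) (H τ) := by
    simpa using continuous_flow_apply W hH 0
  have key : ∀ t : ℝ, ∫ τ in (0 : ℝ)..t, flow W (t - τ) (H τ) =
      flow W t (∫ τ in (0 : ℝ)..t, flow W (-τ) (H τ)) := by
    intro t
    rw [← ContinuousLinearMap.intervalIntegral_comp_comm _ (hc.intervalIntegrable _ _)]
    refine intervalIntegral.integral_congr fun τ _ => ?_
    simp only [sub_eq_add_neg, flow_add]
    rfl
  have h1 := (hasDerivAt_flow W t).clm_apply (hc.integral_hasStrictDerivAt 0 t).hasDerivAt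
  have h2 : flow W t (flow W (-t) (H t)) = H t := by
    have := congrArg (fun A : E →L[ℝ] E => A (H t)) (flow_add W t (-t))
    simpa [flow_zero] using this.symm
  rw [key t]
  rw [h2] at h1
  refine (h1.congr_of_eventuallyEq (Filter.Eventually.of_forall key))

end Flow

/-! ### Suprema over the time interval -/

section SupNorm

variable {E : Type*} [NormedAddCommGroup E]

/-- The supremum of the norm of a curve over `[-T, T]`. -/
noncomputable def supNorm (T : ℝ) (p : ℝ → E) : ℝ := ⨆ t : Set.Icc (-T) T, ‖p t‖

theorem le_supNorm {T : ℝ} {p : ℝ → E} (hp : Continuous p) {t : ℝ} (ht : t ∈ Set.Icc (-T) T) :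
    ‖p t‖ ≤ supNorm T p := by
  have hb : BddAbove (Set.range fun t : Set.Icc (-T) T => ‖p t‖) :=
    (isCompact_range (by fun_prop)).bddAbove
  exact le_ciSup hb ⟨t, ht⟩

theorem supNorm_nonneg (T : ℝ) (p : ℝ → E) : 0 ≤ supNorm T p :=
  Real.iSup_nonneg fun _ => norm_nonneg _

theorem supNorm_le {T : ℝ} {p : ℝ → E} {c : ℝ} (hc : 0 ≤ c)
    (h : ∀ t ∈ Set.Icc (-T) T, ‖p t‖ ≤ c) : supNorm T p ≤ c :=
  Real.iSup_le (fun t => h t t.2) hc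

end SupNorm

/-! ### The abstract Dyson series and the gain from the normal form -/

section Dyson

variable {E : Type*} [NormedAddCommGroup E] [NormedSpace ℝ E]

/-- The recursion of the Dyson series of `∂ₜu + W u + ε N(u, u) = 0`, `u(0) = a`. -/
structure IsDyson (W : E →L[ℝ] E) (N : E →L[ℝ] E →L[ℝ] E) (ε : ℝ) (a : E)
    (u : ℕ → ℝ → E) : Prop where
  zero : ∀ t, u 0 t = flow W t a
  succ : ∀ n t, u (n + 1) t = -(ε • ∫ τ in (0 : ℝ)..t, flow W (t - τ)
    (∑ p ∈ Finset.HasAntidiagonal.antidiagonal n, N (u p.1 τ) (u p.2 τ)))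

/-- The forcing term in the equation for the `n`-th term of the Dyson series. -/
noncomputable def source (N : E →L[ℝ] E →L[ℝ] E) (ε : ℝ) (u : ℕ → ℝ → E) : ℕ → ℝ → E
  | 0 => fun _ => 0
  | n + 1 => fun t =>
      -(ε • ∑ p ∈ Finset.HasAntidiagonal.antidiagonal n, N (u p.1 t) (u p.2 t))

variable {W : E →L[ℝ] E} {N B : E →L[ℝ] E →L[ℝ] E} {ε : ℝ} {a : E}
  {u : ℕ → ℝ → E}

theorem continuous_sum_antidiagonal (n : ℕ) (h : ∀ m ≤ n, Continuous (u m)) :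
    Continuous fun t => ∑ p ∈ Finset.HasAntidiagonal.antidiagonal n, N (u p.1 t) (u p.2 t) := by
  refine continuous_finsetSum _ fun p hp => ?_
  have hp' := Finset.HasAntidiagonal.mem_antidiagonal.1 hp
  exact (N.continuous.comp (h p.1 (by omega))).clm_apply (h p.2 (by omega))

theorem IsDyson.zero_datum (W : E →L[ℝ] E) (N : E →L[ℝ] E →L[ℝ] E) (ε : ℝ) :
    IsDyson W N ε 0 fun _ _ => 0 where
  zero t := by simp
  succ n t := by simp

/-- A normal form for the bilinear term `N` with respect to the group generated by `W`. -/
structure NormalForm (W : E →L[ℝ] E) (N B : E →L[ℝ] E →L[ℝ] E) (T lam b κ : ℝ) : Prop where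
  T_pos : 0 < T
  lam_nonneg : 0 ≤ lam
  lam_mul_le : lam * T ≤ 1
  b_nonneg : 0 ≤ b
  κ_nonneg : 0 ≤ κ
  norm_flow_le : ∀ t x, ‖flow W t x‖ ≤ ‖x‖
  eq : ∀ p q, N p q = lam • B p q + W (B p q) - B (W p) q - B p (W q)
  norm_le : ∀ p q, ‖B p q‖ ≤ b * ‖p‖ * ‖q‖
  norm_le_left : ∀ p q r, ‖B (N p q) r‖ ≤ κ * ‖p‖ * ‖q‖ * ‖r‖
  norm_le_right : ∀ p q r, ‖B r (N p q)‖ ≤ κ * ‖p‖ * ‖q‖ * ‖r‖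

variable [CompleteSpace E]

theorem IsDyson.continuous (hu : IsDyson W N ε a u) (n : ℕ) : Continuous (u n) := by
  induction n using Nat.strong_induction_on with
  | _ n ih =>
    cases n with
    | zero =>
      rw [show u 0 = fun t => flow W t a from funext hu.zero]
      exact (continuous_flow W).clm_apply continuous_const
    | succ n =>
      have hc := continuous_sum_antidiagonal (N := N) n fun m hm => ih m (by omega)
      rw [show u (n + 1) = _ from funext (hu.succ n)]
      refine (Continuous.const_smul ?_ ε).neg
      exact continuous_iff_continuousAt.2 fun t => (hasDerivAt_integral_flow W hc t).continuousAt

theorem IsDyson.continuous_source (hu : IsDyson W N ε a u) (n : ℕ) :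
    Continuous (source N ε u n) := by
  cases n with
  | zero => exact continuous_const
  | succ n => exact ((continuous_sum_antidiagonal n fun m _ => hu.continuous m).const_smul ε).neg

theorem IsDyson.hasDerivAt (hu : IsDyson W N ε a u) (n : ℕ) (t : ℝ) :
    HasDerivAt (u n) (-(W (u n t)) + source N ε u n t) t := by
  cases n with
  | zero =>
    have h := (hasDerivAt_flow W t).clm_apply (hasDerivAt_const t a)
    rw [show u 0 = fun t => flow W t a from funext hu.zero]
    simpa [source] using h
  | succ n =>
    have hc := continuous_sum_antidiagonal (N := N) n fun m _ => hu.continuous m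
    have h := ((hasDerivAt_integral_flow W hc t).const_smul ε).neg
    rw [show u (n + 1) = _ from funext (hu.succ n)]
    refine h.congr_deriv ?_
    simp only [source, map_neg, map_smul, smul_add, smul_neg, neg_add, neg_neg]

/-- The curve `B(p, q)` solves the linear equation with forcing `N(p, q) - (λB(p, q) - B(P, q) -
B(p, Q))`. Duhamel's formula evaluates the integral of this forcing as two boundary terms, each at
most `bαγ`. The remainder contributes a third `bαγ`, because `λT ≤ 1`, and `T(ρ₁ + ρ₂)`. -/
theorem NormalForm.norm_integral_le {T lam b κ : ℝ} (h : NormalForm W N B T lam b κ)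
    {p q P Q : ℝ → E} (hp : ∀ t, HasDerivAt p (-(W (p t)) + P t) t)
    (hq : ∀ t, HasDerivAt q (-(W (q t)) + Q t) t) (hP : Continuous P) (hQ : Continuous Q)
    {α γ ρ₁ ρ₂ : ℝ} (hα : ∀ t ∈ Set.Icc (-T) T, ‖p t‖ ≤ α) (hγ : ∀ t ∈ Set.Icc (-T) T, ‖q t‖ ≤ γ)
    (h₁ : ∀ t ∈ Set.Icc (-T) T, ‖B (P t) (q t)‖ ≤ ρ₁)
    (h₂ : ∀ t ∈ Set.Icc (-T) T, ‖B (p t) (Q t)‖ ≤ ρ₂) {t : ℝ} (ht : t ∈ Set.Icc (-T) T) :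
    ‖∫ τ in (0 : ℝ)..t, flow W (t - τ) (N (p τ) (q τ))‖ ≤ 3 * b * α * γ + T * (ρ₁ + ρ₂) := by
  have hT := h.T_pos
  have h0 : (0 : ℝ) ∈ Set.Icc (-T) T := ⟨by linarith, hT.le⟩
  have hpc : Continuous p := continuous_iff_continuousAt.2 fun t => (hp t).continuousAt
  have hqc : Continuous q := continuous_iff_continuousAt.2 fun t => (hq t).continuousAt
  have hbil : ∀ (A : E →L[ℝ] E →L[ℝ] E) {f g : ℝ → E}, Continuous f → Continuous g →
      Continuous fun τ => A (f τ) (g τ) := fun A f g hf hg =>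
    (A.continuous.comp hf).clm_apply hg
  have hG := hbil B hpc hqc
  have hR : Continuous fun τ => lam • B (p τ) (q τ) - B (P τ) (q τ) - B (p τ) (Q τ) :=
    ((hG.const_smul lam).sub (hbil B hP hqc)).sub (hbil B hpc hQ)
  have hN := hbil N hpc hqc
  have hNR : Continuous fun τ =>
      N (p τ) (q τ) - (lam • B (p τ) (q τ) - B (P τ) (q τ) - B (p τ) (Q τ)) := hN.sub hR
  -- The defining identity of the normal form turns `-B(Wp, q) - B(p, Wq)` into `N(p, q) - λB(p, q)
  -- - WB(p, q)`.
  have hd : ∀ τ, HasDerivAt (fun τ => B (p τ) (q τ)) (-(W (B (p τ) (q τ))) +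
      (N (p τ) (q τ) - (lam • B (p τ) (q τ) - B (P τ) (q τ) - B (p τ) (Q τ)))) τ := by
    intro τ
    have h1 := (B.hasFDerivAt.comp_hasDerivAt τ (hp τ)).clm_apply (hq τ)
    refine h1.congr_deriv ?_
    rw [h.eq]
    simp only [Function.comp_apply, map_add, map_neg, add_apply,
      neg_apply]
    abel
  have hduh := integral_flow_eq W hNR hd t
  have hsplit : ∫ τ in (0 : ℝ)..t, flow W (t - τ) (N (p τ) (q τ)) =
      (∫ τ in (0 : ℝ)..t, (flow W (t - τ)
        (N (p τ) (q τ) - (lam • B (p τ) (q τ) - B (P τ) (q τ) - B (p τ) (Q τ))))) +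
      ∫ τ in (0 : ℝ)..t, flow W (t - τ)
        (lam • B (p τ) (q τ) - B (P τ) (q τ) - B (p τ) (Q τ)) := by
    rw [← intervalIntegral.integral_add
      ((continuous_flow_apply W hNR t).intervalIntegrable _ _)
      ((continuous_flow_apply W hR t).intervalIntegrable _ _)]
    refine intervalIntegral.integral_congr fun τ _ => ?_
    simp only [← map_add, sub_add_cancel]
  have hGb : ∀ τ ∈ Set.Icc (-T) T, ‖B (p τ) (q τ)‖ ≤ b * α * γ := fun τ hτ =>
    (h.norm_le _ _).trans (mul_le_mul (mul_le_mul_of_nonneg_left (hα τ hτ) h.b_nonneg) (hγ τ hτ)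
      (norm_nonneg _) (mul_nonneg h.b_nonneg ((norm_nonneg _).trans (hα τ hτ))))
  have hbnn : 0 ≤ b * α * γ := (norm_nonneg _).trans (hGb 0 h0)
  have hρ₁ : 0 ≤ ρ₁ := (norm_nonneg _).trans (h₁ 0 h0)
  have hρ₂ : 0 ≤ ρ₂ := (norm_nonneg _).trans (h₂ 0 h0)
  have hI := intervalIntegral.norm_integral_le_of_norm_le_const (a := 0) (b := t)
    (C := lam * (b * α * γ) + ρ₁ + ρ₂)
    (f := fun τ => flow W (t - τ) (lam • B (p τ) (q τ) - B (P τ) (q τ) - B (p τ) (Q τ)))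
    (fun τ hτ => by
      have hτ' : τ ∈ Set.Icc (-T) T := by
        have := Set.uIoc_subset_uIcc hτ
        exact (Set.uIcc_subset_Icc h0 ht) this
      refine (h.norm_flow_le _ _).trans ((norm_sub_le _ _).trans
        (add_le_add ((norm_sub_le _ _).trans (add_le_add ?_ (h₁ τ hτ'))) (h₂ τ hτ')))
      rw [norm_smul, Real.norm_of_nonneg h.lam_nonneg]
      exact mul_le_mul_of_nonneg_left (hGb τ hτ') h.lam_nonneg)
  have htT : |t - 0| ≤ T := by rw [sub_zero]; exact abs_le.2 ht
  have hI' : (lam * (b * α * γ) + ρ₁ + ρ₂) * |t - 0| ≤ b * α * γ + T * (ρ₁ + ρ₂) := by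
    have hl := h.lam_nonneg
    calc (lam * (b * α * γ) + ρ₁ + ρ₂) * |t - 0| ≤ (lam * (b * α * γ) + ρ₁ + ρ₂) * T := by gcongr
      _ = (lam * T) * (b * α * γ) + T * (ρ₁ + ρ₂) := by ring
      _ ≤ 1 * (b * α * γ) + T * (ρ₁ + ρ₂) := by have := h.lam_mul_le; gcongr
      _ = _ := by ring
  rw [hsplit]
  have hA : ‖∫ τ in (0 : ℝ)..t, (flow W (t - τ)
        (N (p τ) (q τ) - (lam • B (p τ) (q τ) - B (P τ) (q τ) - B (p τ) (Q τ))))‖ ≤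
      b * α * γ + b * α * γ := by
    refine (congrArg norm hduh).le.trans ?_
    exact (norm_sub_le _ _).trans
      (add_le_add (hGb t ht) ((h.norm_flow_le _ _).trans (hGb 0 h0)))
  calc _ ≤ _ := norm_add_le _ _
    _ ≤ (b * α * γ + b * α * γ) + (b * α * γ + T * (ρ₁ + ρ₂)) :=
      add_le_add hA (hI.trans hI')
    _ = _ := by ring

end Dyson

/-! ### Cauchy products and geometrically weighted partial sums -/

section Sequences

/-- The Cauchy product of two sequences. -/
def conv (f g : ℕ → ℝ) (n : ℕ) : ℝ := ∑ p ∈ Finset.HasAntidiagonal.antidiagonal n, f p.1 * g p.2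

/-- The sequence `0, f 0, f 1, …`. -/
def shift (f : ℕ → ℝ) : ℕ → ℝ
  | 0 => 0
  | n + 1 => f n

/-- The partial sums of `∑ 2ⁿ f n`. -/
def wsum (f : ℕ → ℝ) (n : ℕ) : ℝ := ∑ k ∈ Finset.range n, 2 ^ k * f k

theorem conv_nonneg {f g : ℕ → ℝ} (hf : ∀ n, 0 ≤ f n) (hg : ∀ n, 0 ≤ g n) (n : ℕ) :
    0 ≤ conv f g n := Finset.sum_nonneg fun _ _ => mul_nonneg (hf _) (hg _)

theorem shift_nonneg {f : ℕ → ℝ} (hf : ∀ n, 0 ≤ f n) (n : ℕ) : 0 ≤ shift f n := by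
  cases n with
  | zero => exact le_rfl
  | succ n => exact hf n

theorem wsum_nonneg {f : ℕ → ℝ} (hf : ∀ n, 0 ≤ f n) (n : ℕ) : 0 ≤ wsum f n :=
  Finset.sum_nonneg fun _ _ => mul_nonneg (by positivity) (hf _)

theorem wsum_add (f g : ℕ → ℝ) (n : ℕ) : wsum (f + g) n = wsum f n + wsum g n := by
  simp only [wsum, Pi.add_apply, mul_add, Finset.sum_add_distrib]

theorem wsum_smul (c : ℝ) (f : ℕ → ℝ) (n : ℕ) : wsum (c • f) n = c * wsum f n := by
  simp only [wsum, Pi.smul_apply, smul_eq_mul, Finset.mul_sum]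
  exact Finset.sum_congr rfl fun _ _ => by ring

theorem wsum_mono_left {f g : ℕ → ℝ} (h : ∀ n, f n ≤ g n) (n : ℕ) : wsum f n ≤ wsum g n :=
  Finset.sum_le_sum fun k _ => mul_le_mul_of_nonneg_left (h k) (by positivity)

theorem wsum_succ' (f : ℕ → ℝ) (n : ℕ) :
    wsum f (n + 1) = f 0 + 2 * wsum (fun k => f (k + 1)) n := by
  simp only [wsum, Finset.sum_range_succ', pow_zero, one_mul, Finset.mul_sum]
  rw [add_comm]
  congr 1
  exact Finset.sum_congr rfl fun _ _ => by ring

theorem wsum_shift_le {f : ℕ → ℝ} (hf : ∀ n, 0 ≤ f n) (n : ℕ) :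
    wsum (shift f) n ≤ 2 * wsum f n := by
  cases n with
  | zero => simp [wsum]
  | succ n =>
    rw [wsum_succ', shift, zero_add]
    refine mul_le_mul_of_nonneg_left ?_ two_pos.le
    rw [show wsum f (n + 1) = wsum f n + 2 ^ n * f n from Finset.sum_range_succ _ _]
    exact le_add_of_nonneg_right (mul_nonneg (by positivity) (hf n))

/-- The weight `2ⁿ` is multiplicative along `p₁ + p₂ = n`, and the triangle `p₁ + p₂ < n` lies in
the square `p₁, p₂ < n`. -/
theorem wsum_conv_le {f g : ℕ → ℝ} (hf : ∀ n, 0 ≤ f n) (hg : ∀ n, 0 ≤ g n) (n : ℕ) :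
    wsum (conv f g) n ≤ wsum f n * wsum g n := by
  have h1 : wsum (conv f g) n = ∑ x ∈ (Finset.range n).sigma
      fun k => Finset.HasAntidiagonal.antidiagonal k,
      (2 ^ x.2.1 * f x.2.1) * (2 ^ x.2.2 * g x.2.2) := by
    rw [Finset.sum_sigma]
    refine Finset.sum_congr rfl fun k _ => ?_
    rw [conv, Finset.mul_sum]
    refine Finset.sum_congr rfl fun p hp => ?_
    rw [← Finset.HasAntidiagonal.mem_antidiagonal.1 hp, pow_add]
    ring
  rw [h1, wsum, wsum, Finset.sum_mul_sum, ← Finset.sum_product']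
  rw [← Finset.sum_image (f := fun p : ℕ × ℕ => (2 ^ p.1 * f p.1) * (2 ^ p.2 * g p.2))
    (g := fun x : (_ : ℕ) × ℕ × ℕ => x.2)]
  · refine Finset.sum_le_sum_of_subset_of_nonneg ?_ fun p _ _ =>
      mul_nonneg (mul_nonneg (by positivity) (hf _)) (mul_nonneg (by positivity) (hg _))
    intro p hp
    obtain ⟨x, hx, rfl⟩ := Finset.mem_image.1 hp
    obtain ⟨hx1, hx2⟩ := Finset.mem_sigma.1 hx
    have h2 := Finset.HasAntidiagonal.mem_antidiagonal.1 hx2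
    have h3 := Finset.mem_range.1 hx1
    exact Finset.mem_product.2 ⟨Finset.mem_range.2 (by omega), Finset.mem_range.2 (by omega)⟩
  · rintro ⟨k, p⟩ hx ⟨l, q⟩ hy (hxy : p = q)
    subst hxy
    have h2 := Finset.HasAntidiagonal.mem_antidiagonal.1 (Finset.mem_sigma.1 hx).2
    have h3 := Finset.HasAntidiagonal.mem_antidiagonal.1 (Finset.mem_sigma.1 hy).2
    simp only at h2 h3
    subst h2
    subst h3
    rfl

end Sequences

/-! ### Bounds on the terms of the series and on their differences -/

section Bounds

variable {E : Type*} [NormedAddCommGroup E] [NormedSpace ℝ E]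
  {W : E →L[ℝ] E} {N B : E →L[ℝ] E →L[ℝ] E} {ε : ℝ} {a a' : E} {u u' : ℕ → ℝ → E}

theorem bilin_sub_bilin (N : E →L[ℝ] E →L[ℝ] E) (p q p' q' : E) :
    N p q - N p' q' = N (p - p') q + N p' (q - q') := by
  simp only [map_sub, sub_apply]
  abel

/-- The source of the `n`-th term involves only indices of sum `n - 1`, hence the `shift`. The
operator `A` stands for `B(·, w)` or `B(w, ·)`, so that the cubic bound of the normal form is used
as a bound on `A ∘ N`, never as one on `B` and `N` separately. -/
theorem norm_source_sub_le (hε : 0 ≤ ε) {c t : ℝ} (hc : 0 ≤ c) {A : E →L[ℝ] E}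
    (hA : ∀ p q, ‖A (N p q)‖ ≤ c * ‖p‖ * ‖q‖) {V V' Δ : ℕ → ℝ} (hV : ∀ n, ‖u n t‖ ≤ V n)
    (hV' : ∀ n, ‖u' n t‖ ≤ V' n) (hΔ : ∀ n, ‖u n t - u' n t‖ ≤ Δ n) (n : ℕ) :
    ‖A (source N ε u n t - source N ε u' n t)‖ ≤
      ε * c * shift (conv Δ V + conv V' Δ) n := by
  cases n with
  | zero => simp [source, shift]
  | succ n =>
    have hs : source N ε u (n + 1) t - source N ε u' (n + 1) t =
        -(ε • ∑ p ∈ Finset.HasAntidiagonal.antidiagonal n,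
          (N (u p.1 t - u' p.1 t) (u p.2 t) + N (u' p.1 t) (u p.2 t - u' p.2 t))) := by
      simp only [source, ← bilin_sub_bilin, Finset.sum_sub_distrib, smul_sub]
      abel
    rw [hs, map_neg, norm_neg, map_smul, norm_smul, Real.norm_of_nonneg hε, mul_assoc]
    refine mul_le_mul_of_nonneg_left ?_ hε
    rw [map_sum]
    refine (norm_sum_le _ _).trans ?_
    simp only [shift, Pi.add_apply, conv, ← Finset.sum_add_distrib, Finset.mul_sum]
    refine Finset.sum_le_sum fun p _ => ?_
    rw [map_add, mul_add, ← mul_assoc, ← mul_assoc]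
    have n1 := (norm_nonneg _).trans (hΔ p.1)
    have n2 := (norm_nonneg _).trans (hV' p.1)
    refine (norm_add_le _ _).trans (add_le_add ?_ ?_)
    · refine (hA _ _).trans ?_
      gcongr
      exacts [hΔ _, hV _]
    · refine (hA _ _).trans ?_
      gcongr
      exacts [hV' _, hΔ _]

theorem norm_source_le (hε : 0 ≤ ε) {c t : ℝ} (hc : 0 ≤ c) {A : E →L[ℝ] E}
    (hA : ∀ p q, ‖A (N p q)‖ ≤ c * ‖p‖ * ‖q‖) {V : ℕ → ℝ} (hV : ∀ n, ‖u n t‖ ≤ V n) (n : ℕ) :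
    ‖A (source N ε u n t)‖ ≤ ε * c * shift (conv V V) n := by
  have h := norm_source_sub_le (u' := fun _ _ => 0) (V' := fun _ => 0) hε hc hA hV
    (by simp) (by simpa using hV) n
  have h0 : source N ε (fun _ _ => (0 : E)) n t = 0 := by cases n <;> simp [source]
  rw [h0, sub_zero] at h
  convert h using 3
  funext n
  simp [conv]

/-- Smallness of the datum relative to the constants of the normal form. -/
structure NormalForm.Small (T b κ ε R : ℝ) : Prop where
  R_nonneg : 0 ≤ R
  ε_nonneg : 0 ≤ ε
  le : 24 * (ε * b * R) + 96 * (ε ^ 2 * T * κ * R ^ 2) ≤ 1 / 2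

/-- One step of the induction on partial sums. With `E` the weighted sum of `Δ`, the quadratic part
is at most `4RE`. In the cubic part each shift costs a factor `2`, and its four terms give `16 + 8 +
8 + 16 = 48` times `R²E`. Doubling explains the `24 = 2 · 3 · 4` and `96 = 2 · 48` in
`NormalForm.Small`. -/
theorem NormalForm.wsum_succ_le {T lam b κ R : ℝ} (h : NormalForm W N B T lam b κ)
    (hR : NormalForm.Small T b κ ε R) {V V' Δ Δs : ℕ → ℝ} (n1 : ∀ n, 0 ≤ V n)
    (n2 : ∀ n, 0 ≤ V' n) (n3 : ∀ n, 0 ≤ Δ n)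
    (hΔs : ∀ n, Δs n ≤ ((3 * (ε * b)) • (conv Δ V + conv V' Δ) +
      (ε ^ 2 * T * κ) • (conv (shift (conv Δ V + conv V' Δ)) V + conv Δ (shift (conv V V)) +
        conv (shift (conv V' V')) Δ + conv V' (shift (conv Δ V + conv V' Δ)))) n) (n : ℕ)
    (hV : wsum V n ≤ 2 * R) (hV' : wsum V' n ≤ 2 * R) :
    2 * wsum Δs n ≤ wsum Δ n / 2 := by
  have e1 := h.b_nonneg
  have e2 := h.κ_nonneg
  have e3 := h.T_pos
  have e4 := hR.R_nonneg
  have e5 := hR.ε_nonneg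
  have w3 := wsum_nonneg n3 n
  have w1 := wsum_nonneg n1 n
  have w2 := wsum_nonneg n2 n
  have nc : ∀ n, 0 ≤ (conv Δ V + conv V' Δ) n := fun n =>
    add_nonneg (conv_nonneg n3 n1 n) (conv_nonneg n2 n3 n)
  set E := wsum Δ n with hE
  have b1 : wsum (conv Δ V + conv V' Δ) n ≤ 4 * R * E := by
    rw [wsum_add]
    have c1 := (wsum_conv_le n3 n1 n).trans (mul_le_mul_of_nonneg_left hV w3)
    have c2 := (wsum_conv_le n2 n3 n).trans (mul_le_mul_of_nonneg_right hV' w3)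
    linarith
  have b2 : wsum (shift (conv Δ V + conv V' Δ)) n ≤ 8 * R * E := by
    have := wsum_shift_le nc n
    linarith
  have b3 : wsum (shift (conv V V)) n ≤ 8 * R ^ 2 := by
    have c1 := wsum_shift_le (conv_nonneg n1 n1) n
    have c2 := (wsum_conv_le n1 n1 n).trans (mul_le_mul hV hV w1 (by positivity))
    linarith
  have b4 : wsum (shift (conv V' V')) n ≤ 8 * R ^ 2 := by
    have c1 := wsum_shift_le (conv_nonneg n2 n2) n
    have c2 := (wsum_conv_le n2 n2 n).trans (mul_le_mul hV' hV' w2 (by positivity))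
    linarith
  have n4 := shift_nonneg nc
  have n5 := shift_nonneg (conv_nonneg n1 n1)
  have n6 := shift_nonneg (conv_nonneg n2 n2)
  have d1 := (wsum_conv_le n4 n1 n).trans (mul_le_mul b2 hV w1 (by positivity))
  have d2 := (wsum_conv_le n3 n5 n).trans (mul_le_mul_of_nonneg_left b3 w3)
  have d3 := (wsum_conv_le n6 n3 n).trans (mul_le_mul_of_nonneg_right b4 w3)
  have d4 := (wsum_conv_le n2 n4 n).trans (mul_le_mul hV' b2 (wsum_nonneg n4 n) (by positivity))
  have hs := wsum_mono_left hΔs n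
  rw [wsum_add, wsum_smul, wsum_smul, wsum_add (_ + _ + _), wsum_add (_ + _),
    wsum_add (conv (shift _) V)] at hs
  have f1 : 3 * (ε * b) * wsum (conv Δ V + conv V' Δ) n ≤ 3 * (ε * b) * (4 * R * E) := by gcongr
  have f2 : ε ^ 2 * T * κ * (wsum (conv (shift (conv Δ V + conv V' Δ)) V) n +
      wsum (conv Δ (shift (conv V V))) n + wsum (conv (shift (conv V' V')) Δ) n +
      wsum (conv V' (shift (conv Δ V + conv V' Δ))) n) ≤ ε ^ 2 * T * κ * (48 * R ^ 2 * E) := by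
    gcongr
    linarith
  have f3 := mul_le_mul_of_nonneg_right hR.le w3
  linarith

variable [CompleteSpace E]

/-- Split `N(u, u) - N(u', u')` bilinearly, exchange sum and integral, and apply the normal form to
each pair of terms. Differences of Dyson terms again solve the linear equation with a source, so
they are admissible curves in `NormalForm.norm_integral_le`. -/
theorem NormalForm.norm_succ_sub_le {T lam b κ : ℝ} (h : NormalForm W N B T lam b κ) (hε : 0 ≤ ε)
    (hu : IsDyson W N ε a u) (hu' : IsDyson W N ε a' u') {V V' Δ : ℕ → ℝ}
    (hV : ∀ n, ∀ t ∈ Set.Icc (-T) T, ‖u n t‖ ≤ V n)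
    (hV' : ∀ n, ∀ t ∈ Set.Icc (-T) T, ‖u' n t‖ ≤ V' n)
    (hΔ : ∀ n, ∀ t ∈ Set.Icc (-T) T, ‖u n t - u' n t‖ ≤ Δ n) (n : ℕ) {t : ℝ}
    (ht : t ∈ Set.Icc (-T) T) :
    ‖u (n + 1) t - u' (n + 1) t‖ ≤ ((3 * (ε * b)) • (conv Δ V + conv V' Δ) +
      (ε ^ 2 * T * κ) • (conv (shift (conv Δ V + conv V' Δ)) V + conv Δ (shift (conv V V)) +
        conv (shift (conv V' V')) Δ + conv V' (shift (conv Δ V + conv V' Δ)))) n := by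
  have hT := h.T_pos
  have h0 : (0 : ℝ) ∈ Set.Icc (-T) T := ⟨by linarith, hT.le⟩
  have n1 : ∀ n, 0 ≤ V n := fun n => (norm_nonneg _).trans (hV n 0 h0)
  have n2 : ∀ n, 0 ≤ V' n := fun n => (norm_nonneg _).trans (hV' n 0 h0)
  have n3 : ∀ n, 0 ≤ Δ n := fun n => (norm_nonneg _).trans (hΔ n 0 h0)
  have hcN : ∀ {f g : ℝ → E}, Continuous f → Continuous g →
      Continuous fun τ => flow W (t - τ) (N (f τ) (g τ)) := fun hf hg =>
    continuous_flow_apply W ((N.continuous.comp hf).clm_apply hg) t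
  have hc := hu.continuous
  have hc' := hu'.continuous
  have hδc : ∀ n, Continuous fun τ => u n τ - u' n τ := fun n => (hc n).sub (hc' n)
  have hδ : ∀ n t, HasDerivAt (fun τ => u n τ - u' n τ) (-(W (u n t - u' n t)) +
      (source N ε u n t - source N ε u' n t)) t := fun n t => by
    refine ((hu.hasDerivAt n t).sub (hu'.hasDerivAt n t)).congr_deriv ?_
    rw [map_sub]
    abel
  have hδs : ∀ n, Continuous fun τ => source N ε u n τ - source N ε u' n τ := fun n =>
    (hu.continuous_source n).sub (hu'.continuous_source n)
  have hL : ∀ {w : E} {v : ℝ}, ‖w‖ ≤ v → ∀ p q, ‖B.flip w (N p q)‖ ≤ κ * v * ‖p‖ * ‖q‖ := by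
    intro w v hw p q
    refine (h.norm_le_left p q w).trans ?_
    have := h.κ_nonneg
    calc κ * ‖p‖ * ‖q‖ * ‖w‖ ≤ κ * ‖p‖ * ‖q‖ * v := by gcongr
      _ = _ := by ring
  have hR : ∀ {w : E} {v : ℝ}, ‖w‖ ≤ v → ∀ p q, ‖B w (N p q)‖ ≤ κ * v * ‖p‖ * ‖q‖ := by
    intro w v hw p q
    refine (h.norm_le_right p q w).trans ?_
    have := h.κ_nonneg
    calc κ * ‖p‖ * ‖q‖ * ‖w‖ ≤ κ * ‖p‖ * ‖q‖ * v := by gcongr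
      _ = _ := by ring
  have hκ := h.κ_nonneg
  have key1 : ∀ i j, ‖∫ τ in (0 : ℝ)..t, flow W (t - τ) (N (u i τ - u' i τ) (u j τ))‖ ≤
      3 * b * Δ i * V j + T * (ε * (κ * V j) * shift (conv Δ V + conv V' Δ) i +
        ε * (κ * Δ i) * shift (conv V V) j) := fun i j =>
    h.norm_integral_le (hδ i) (hu.hasDerivAt j) (hδs i) (hu.continuous_source j) (hΔ i) (hV j)
      (fun τ hτ => norm_source_sub_le (A := B.flip (u j τ)) hε (mul_nonneg hκ (n1 j))
        (hL (hV j τ hτ)) (fun n => hV n τ hτ) (fun n => hV' n τ hτ) (fun n => hΔ n τ hτ) i)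
      (fun τ hτ => norm_source_le (A := B (u i τ - u' i τ)) hε (mul_nonneg hκ (n3 i))
        (hR (hΔ i τ hτ)) (fun n => hV n τ hτ) j) ht
  have key2 : ∀ i j, ‖∫ τ in (0 : ℝ)..t, flow W (t - τ) (N (u' i τ) (u j τ - u' j τ))‖ ≤
      3 * b * V' i * Δ j + T * (ε * (κ * Δ j) * shift (conv V' V') i +
        ε * (κ * V' i) * shift (conv Δ V + conv V' Δ) j) := fun i j =>
    h.norm_integral_le (hu'.hasDerivAt i) (hδ j) (hu'.continuous_source i) (hδs j) (hV' i) (hΔ j)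
      (fun τ hτ => norm_source_le (A := B.flip (u j τ - u' j τ)) hε (mul_nonneg hκ (n3 j))
        (hL (hΔ j τ hτ)) (fun n => hV' n τ hτ) i)
      (fun τ hτ => norm_source_sub_le (A := B (u' i τ)) hε (mul_nonneg hκ (n2 i))
        (hR (hV' i τ hτ)) (fun n => hV n τ hτ) (fun n => hV' n τ hτ) (fun n => hΔ n τ hτ) j) ht
  have hsum : u (n + 1) t - u' (n + 1) t = -(ε • ∑ p ∈ Finset.HasAntidiagonal.antidiagonal n,
      ((∫ τ in (0 : ℝ)..t, flow W (t - τ) (N (u p.1 τ - u' p.1 τ) (u p.2 τ))) +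
        ∫ τ in (0 : ℝ)..t, flow W (t - τ) (N (u' p.1 τ) (u p.2 τ - u' p.2 τ)))) := by
    have hi : ∀ {v : ℕ → ℝ → E}, (∀ n, Continuous (v n)) →
        ∫ τ in (0 : ℝ)..t, flow W (t - τ)
          (∑ p ∈ Finset.HasAntidiagonal.antidiagonal n, N (v p.1 τ) (v p.2 τ)) =
        ∑ p ∈ Finset.HasAntidiagonal.antidiagonal n,
          ∫ τ in (0 : ℝ)..t, flow W (t - τ) (N (v p.1 τ) (v p.2 τ)) := by
      intro v hv
      simp only [map_sum]
      exact intervalIntegral.integral_finsetSum fun p _ =>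
        (hcN (hv p.1) (hv p.2)).intervalIntegrable _ _
    rw [hu.succ, hu'.succ, hi hc, hi hc', neg_sub_neg, ← smul_sub, ← neg_sub, smul_neg,
      ← Finset.sum_sub_distrib]
    congr 2
    refine Finset.sum_congr rfl fun p _ => ?_
    rw [← intervalIntegral.integral_sub ((hcN (hc p.1) (hc p.2)).intervalIntegrable _ _)
        ((hcN (hc' p.1) (hc' p.2)).intervalIntegrable _ _),
      ← intervalIntegral.integral_add ((hcN (hδc p.1) (hc p.2)).intervalIntegrable _ _)
        ((hcN (hc' p.1) (hδc p.2)).intervalIntegrable _ _)]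
    refine intervalIntegral.integral_congr fun τ _ => ?_
    simp only [← map_sub (flow W (t - τ)), ← map_add (flow W (t - τ)), bilin_sub_bilin]
  rw [hsum, norm_neg, norm_smul, Real.norm_of_nonneg hε]
  refine (mul_le_mul_of_nonneg_left ((norm_sum_le _ _).trans (Finset.sum_le_sum fun p _ =>
    (norm_add_le _ _).trans (add_le_add (key1 p.1 p.2) (key2 p.1 p.2)))) hε).trans (le_of_eq ?_)
  generalize shift (conv Δ V + conv V' Δ) = Δc
  generalize shift (conv V V) = Vc
  generalize shift (conv V' V') = Vc'
  simp only [Pi.add_apply, Pi.smul_apply, smul_eq_mul, conv, Finset.mul_sum,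
    ← Finset.sum_add_distrib]
  refine Finset.sum_congr rfl fun p _ => ?_
  ring

/-- The summed bound on the terms of the Dyson series. -/
theorem NormalForm.wsum_supNorm_le {T lam b κ R : ℝ} (h : NormalForm W N B T lam b κ)
    (hR : NormalForm.Small T b κ ε R) (hu : IsDyson W N ε a u) (ha : ‖a‖ ≤ R) (n : ℕ) :
    wsum (fun k => supNorm T (u k)) n ≤ 2 * R ∧
      2 * wsum (fun k => supNorm T (u (k + 1))) n ≤ R := by
  have hle : ∀ n, ∀ t ∈ Set.Icc (-T) T, ‖u n t‖ ≤ supNorm T (u n) := fun n t ht =>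
    le_supNorm (hu.continuous n) ht
  have hnn : ∀ n, 0 ≤ supNorm T (u n) := fun n => supNorm_nonneg T _
  -- The bound for a single series is the difference bound against the zero solution.
  have hstep := h.norm_succ_sub_le hR.ε_nonneg hu (IsDyson.zero_datum W N ε)
    (V := fun k => supNorm T (u k)) (V' := fun _ => 0) (Δ := fun k => supNorm T (u k)) hle
    (by simp) (by simpa using hle)
  have hrec := fun n => supNorm_le (T := T) (p := u (n + 1)) ((norm_nonneg _).trans
    (hstep n (t := 0) ⟨by linarith [h.T_pos], h.T_pos.le⟩))
    (fun t ht => by simpa only [sub_zero] using hstep n ht)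
  have h0 : supNorm T (u 0) ≤ R := supNorm_le hR.R_nonneg fun t _ => by
    rw [hu.zero]
    exact (h.norm_flow_le _ _).trans ha
  have hz : ∀ n, wsum (fun _ => 0) n = 0 := fun n => by simp [wsum]
  have hnext : ∀ n, wsum (fun k => supNorm T (u k)) n ≤ 2 * R →
      2 * wsum (fun k => supNorm T (u (k + 1))) n ≤ R := fun n hn => by
    have := h.wsum_succ_le hR hnn (fun _ => le_rfl) hnn hrec n hn
      ((hz n).le.trans (by linarith [hR.R_nonneg]))
    linarith
  -- The partial sum of length `n + 1` is the zeroth term plus twice the shifted partial sum of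
  -- length `n`, hence at most `R + R`.
  have hmain : ∀ n, wsum (fun k => supNorm T (u k)) n ≤ 2 * R := by
    intro n
    induction n with
    | zero => simpa [wsum] using hR.R_nonneg
    | succ n ih =>
      rw [wsum_succ']
      linarith [hnext n ih]
  exact ⟨hmain n, hnext n (hmain n)⟩

theorem NormalForm.supNorm_le {T lam b κ R : ℝ} (h : NormalForm W N B T lam b κ)
    (hR : NormalForm.Small T b κ ε R) (hu : IsDyson W N ε a u) (ha : ‖a‖ ≤ R) (n : ℕ) :
    supNorm T (u n) ≤ (1 / 2) ^ n * R := by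
  cases n with
  | zero =>
    rw [pow_zero, one_mul]
    refine BBM.supNorm_le hR.R_nonneg fun t _ => ?_
    rw [hu.zero]
    exact (h.norm_flow_le _ _).trans ha
  | succ n =>
    have h1 := (h.wsum_supNorm_le hR hu ha (n + 1)).2
    have h2 : 2 ^ n * supNorm T (u (n + 1)) ≤ wsum (fun k => supNorm T (u (k + 1))) (n + 1) :=
      Finset.single_le_sum (f := fun k => 2 ^ k * supNorm T (u (k + 1)))
        (fun k _ => mul_nonneg (by positivity) (supNorm_nonneg T _)) (Finset.self_mem_range_succ n)
    rw [one_div, inv_pow, ← div_eq_inv_mul, le_div_iff₀ (by positivity), pow_succ]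
    linarith

/-- The weighted partial sums `Eₙ` of the differences satisfy `Eₙ₊₁ ≤ ‖a - a'‖ + Eₙ / 2`, hence stay
below `2‖a - a'‖`. -/
theorem NormalForm.sum_norm_sub_le {T lam b κ R : ℝ} (h : NormalForm W N B T lam b κ)
    (hR : NormalForm.Small T b κ ε R) (hu : IsDyson W N ε a u) (hu' : IsDyson W N ε a' u')
    (ha : ‖a‖ ≤ R) (ha' : ‖a'‖ ≤ R) {t : ℝ} (ht : t ∈ Set.Icc (-T) T) (n : ℕ) :
    ∑ k ∈ Finset.range n, ‖u k t - u' k t‖ ≤ 2 * ‖a - a'‖ := by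
  have hc : ∀ n, Continuous fun t => u n t - u' n t := fun n =>
    (hu.continuous n).sub (hu'.continuous n)
  have hΔ : ∀ n, ∀ t ∈ Set.Icc (-T) T, ‖u n t - u' n t‖ ≤ supNorm T fun t => u n t - u' n t :=
    fun n t ht => le_supNorm (p := fun t => u n t - u' n t) (hc n) ht
  have hstep := h.norm_succ_sub_le hR.ε_nonneg hu hu' (V := fun k => supNorm T (u k))
    (V' := fun k => supNorm T (u' k)) (Δ := fun k => supNorm T fun t => u k t - u' k t)
    (fun n t ht => le_supNorm (hu.continuous n) ht)
    (fun n t ht => le_supNorm (hu'.continuous n) ht) hΔ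
  have hrec := fun n => BBM.supNorm_le (T := T) (p := fun t => u (n + 1) t - u' (n + 1) t)
    ((norm_nonneg _).trans (hstep n (t := 0) ⟨by linarith [h.T_pos], h.T_pos.le⟩))
    (fun t ht => hstep n ht)
  have h0 : (supNorm T fun t => u 0 t - u' 0 t) ≤ ‖a - a'‖ :=
    BBM.supNorm_le (norm_nonneg _) fun t _ => by
      rw [hu.zero, hu'.zero, ← map_sub]
      exact h.norm_flow_le _ _
  have hmain : ∀ n, wsum (fun k => supNorm T fun t => u k t - u' k t) n ≤ 2 * ‖a - a'‖ := by
    intro n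
    induction n with
    | zero => simp [wsum]
    | succ n ih =>
      rw [wsum_succ']
      have := h.wsum_succ_le hR (fun n => supNorm_nonneg T _) (fun n => supNorm_nonneg T _)
        (fun n => supNorm_nonneg T _) hrec n (h.wsum_supNorm_le hR hu ha n).1
        (h.wsum_supNorm_le hR hu' ha' n).1
      linarith
  refine le_trans (Finset.sum_le_sum fun k _ => ?_) (hmain n)
  refine (hΔ k t ht).trans (le_mul_of_one_le_left (supNorm_nonneg T _) (one_le_pow₀ one_le_two))

end Bounds

/-! ### Uniqueness, and the sum of the series as the solution -/

section WellPosed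

variable {E : Type*} [NormedAddCommGroup E] [NormedSpace ℝ E]
  {W : E →L[ℝ] E} {N B : E →L[ℝ] E →L[ℝ] E} {ε : ℝ} {a a' : E}

/-- `u ∈ C([-T,T], E)` solves `∂ₜu + W u + ε N(u, u) = 0`, `u(0) = a`. -/
def SolvesOn (W : E →L[ℝ] E) (N : E →L[ℝ] E →L[ℝ] E) (ε T : ℝ) (a : E) (u : ℝ → E) : Prop :=
  ContinuousOn u (Set.Icc (-T) T) ∧ u 0 = a ∧
    ∀ t ∈ Set.Icc (-T) T,
      HasDerivWithinAt u (-(W (u t) + ε • N (u t) (u t))) (Set.Icc (-T) T) t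

theorem lipschitzOnWith_quadratic (W : E →L[ℝ] E) (N : E →L[ℝ] E →L[ℝ] E) (ε ρ : ℝ) (hρ : 0 ≤ ρ) :
    LipschitzOnWith (Real.toNNReal (‖W‖ + |ε| * (2 * ‖N‖ * ρ)))
      (fun x => -(W x + ε • N x x)) (Metric.closedBall 0 ρ) := by
  refine LipschitzOnWith.of_dist_le_mul fun x hx y hy => ?_
  rw [mem_closedBall_zero_iff] at hx hy
  rw [Real.coe_toNNReal _ (by positivity), dist_eq_norm, dist_eq_norm]
  have h1 : -(W x + ε • N x x) - -(W y + ε • N y y) =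
      -(W (x - y) + ε • (N (x - y) x + N y (x - y))) := by
    rw [← bilin_sub_bilin, map_sub, smul_sub]
    abel
  rw [h1, norm_neg]
  calc ‖W (x - y) + ε • (N (x - y) x + N y (x - y))‖
      ≤ ‖W‖ * ‖x - y‖ + |ε| * (‖N‖ * ‖x - y‖ * ρ + ‖N‖ * ρ * ‖x - y‖) := by
        refine (norm_add_le _ _).trans (add_le_add (W.le_opNorm _) ?_)
        rw [norm_smul, Real.norm_eq_abs]
        refine mul_le_mul_of_nonneg_left ((norm_add_le _ _).trans (add_le_add ?_ ?_)) (abs_nonneg _)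
        · exact (N.le_opNorm₂ _ _).trans (by gcongr)
        · exact (N.le_opNorm₂ _ _).trans (by gcongr)
    _ = _ := by ring

/-- Two continuous solutions stay in a common ball on the compact interval, where the vector field
is Lipschitz. No smallness is needed. -/
theorem SolvesOn.eqOn {T : ℝ} (hT : 0 < T) {u v : ℝ → E} (hu : SolvesOn W N ε T a u)
    (hv : SolvesOn W N ε T a v) : Set.EqOn u v (Set.Icc (-T) T) := by
  obtain ⟨c1, h1⟩ := isCompact_Icc.exists_bound_of_continuousOn hu.1
  obtain ⟨c2, h2⟩ := isCompact_Icc.exists_bound_of_continuousOn hv.1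
  have hd : ∀ {f : ℝ → E}, SolvesOn W N ε T a f → ∀ t ∈ Set.Ioo (-T) T,
      HasDerivAt f (-(W (f t) + ε • N (f t) (f t))) t := fun hf t ht =>
    (hf.2.2 t (Set.Ioo_subset_Icc_self ht)).hasDerivAt (Icc_mem_nhds ht.1 ht.2)
  refine ODE_solution_unique_of_mem_Icc
    (v := fun _ x => -(W x + ε • N x x)) (s := fun _ => Metric.closedBall 0 (max (max c1 c2) 0))
    (t₀ := 0) (fun t _ => lipschitzOnWith_quadratic W N ε _ (le_max_right _ _))
    ⟨by linarith, hT⟩ hu.1 (hd hu) (fun t ht => ?_) hv.1 (hd hv) (fun t ht => ?_)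
    (hu.2.1.trans hv.2.1.symm)
  · rw [mem_closedBall_zero_iff]
    exact (h1 t (Set.Ioo_subset_Icc_self ht)).trans ((le_max_left _ _).trans (le_max_left _ _))
  · rw [mem_closedBall_zero_iff]
    exact (h2 t (Set.Ioo_subset_Icc_self ht)).trans ((le_max_right _ _).trans (le_max_left _ _))

variable [CompleteSpace E]

/-- The Cauchy product of two absolutely convergent series, for a bounded bilinear map. -/
theorem hasSum_bilin_antidiagonal (N : E →L[ℝ] E →L[ℝ] E) {f : ℕ → E} {V : ℕ → ℝ}
    (hV : Summable V) (hf : ∀ n, ‖f n‖ ≤ V n) :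
    HasSum (fun n => ∑ p ∈ Finset.HasAntidiagonal.antidiagonal n, N (f p.1) (f p.2))
      (N (∑' n, f n) (∑' n, f n)) := by
  have hn : ∀ n, 0 ≤ V n := fun n => (norm_nonneg _).trans (hf n)
  have hs : HasSum f (∑' n, f n) := (Summable.of_norm_bounded hV hf).hasSum
  have hs2 : Summable fun p : ℕ × ℕ => N (f p.1) (f p.2) := by
    refine Summable.of_norm_bounded ((hV.mul_of_nonneg hV hn hn).mul_left ‖N‖) fun p => ?_
    refine (N.le_opNorm₂ _ _).trans ?_
    rw [mul_assoc]
    refine mul_le_mul_of_nonneg_left ?_ N.opNorm_nonneg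
    exact mul_le_mul (hf _) (hf _) (norm_nonneg _) (hn _)
  have hval : ∑' p : ℕ × ℕ, N (f p.1) (f p.2) = N (∑' n, f n) (∑' n, f n) :=
    (hs2.hasSum.prod_fiberwise fun i => (N (f i)).hasSum hs).unique
      ((N.flip (∑' n, f n)).hasSum hs)
  have h1 := hs2.hasSum
  rw [hval, ← Finset.HasAntidiagonal.sigmaAntidiagonalEquivProd.hasSum_iff] at h1
  have h2 := h1.sigma fun n => hasSum_fintype _
  convert h2 using 2 with n
  exact (Finset.sum_coe_sort (Finset.HasAntidiagonal.antidiagonal n)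
    fun p => N (f p.1) (f p.2)).symm

/-- Dominated convergence: the `n`-th integrand is at most `‖N‖` times the `n`-th term of the Cauchy
square of `V`, which is summable and independent of time. -/
theorem hasSum_integral_bilin_antidiagonal (hW : ∀ t x, ‖flow W t x‖ ≤ ‖x‖) {u : ℕ → ℝ → E}
    (hu : ∀ n, Continuous (u n)) {V : ℕ → ℝ} (hV : Summable V) {t : ℝ}
    (hb : ∀ n, ∀ τ ∈ Set.uIcc 0 t, ‖u n τ‖ ≤ V n) {w : ℝ → E}
    (hw : ∀ τ ∈ Set.uIcc 0 t, w τ = ∑' n, u n τ) :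
    HasSum (fun n => ∫ τ in (0 : ℝ)..t, flow W (t - τ)
        (∑ p ∈ Finset.HasAntidiagonal.antidiagonal n, N (u p.1 τ) (u p.2 τ)))
      (∫ τ in (0 : ℝ)..t, flow W (t - τ) (N (w τ) (w τ))) := by
  have hVn : ∀ n, 0 ≤ V n := fun n => (norm_nonneg _).trans (hb n 0 Set.left_mem_uIcc)
  have hcs : Summable fun n => ‖N‖ * conv V V n :=
    (summable_sum_mul_antidiagonal_of_summable_mul (hV.mul_of_nonneg hV hVn hVn)).mul_left _
  refine intervalIntegral.hasSum_integral_of_dominated_convergence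
    (fun n _ => ‖N‖ * conv V V n) (fun n => ?_) (fun n => ?_)
    (Filter.Eventually.of_forall fun τ _ => hcs) (continuous_const.intervalIntegrable _ _) ?_
  · exact (continuous_flow_apply W (continuous_sum_antidiagonal n
      fun m _ => hu m) t).aestronglyMeasurable
  · refine Filter.Eventually.of_forall fun τ hτ' => ?_
    have hτ := Set.uIoc_subset_uIcc hτ'
    refine (hW _ _).trans ((norm_sum_le _ _).trans ?_)
    rw [conv, Finset.mul_sum]
    refine Finset.sum_le_sum fun p _ => ?_
    refine (N.le_opNorm₂ _ _).trans ?_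
    rw [mul_assoc]
    refine mul_le_mul_of_nonneg_left ?_ N.opNorm_nonneg
    exact mul_le_mul (hb _ τ hτ) (hb _ τ hτ) (norm_nonneg _) (hVn _)
  · refine Filter.Eventually.of_forall fun τ hτ' => ?_
    have hτ := Set.uIoc_subset_uIcc hτ'
    have h1 := hasSum_bilin_antidiagonal (f := fun n => u n τ) N hV fun n => hb n τ hτ
    rw [← hw τ hτ] at h1
    exact (flow W (t - τ)).hasSum h1

/-- Summing the recursion shows that the sum of the series equals the right side of Duhamel's
formula on the interval, and that side is differentiable. -/
theorem NormalForm.solvesOn_tsum {T lam b κ R : ℝ} (h : NormalForm W N B T lam b κ)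
    (hR : NormalForm.Small T b κ ε R) {u : ℕ → ℝ → E} (hu : IsDyson W N ε a u) (ha : ‖a‖ ≤ R) :
    SolvesOn W N ε T a (fun t => ∑' n, u n t) := by
  have hT := h.T_pos
  have hTT : -T ≤ T := by linarith
  have h0 : (0 : ℝ) ∈ Set.Icc (-T) T := ⟨by linarith, hT.le⟩
  set V : ℕ → ℝ := fun n => (1 / 2) ^ n * R with hVdef
  have hV : Summable V := (summable_geometric_of_lt_one (by norm_num) (by norm_num)).mul_right R
  have hVn : ∀ n, 0 ≤ V n := fun n => mul_nonneg (by positivity) hR.R_nonneg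
  have hb : ∀ n, ∀ t ∈ Set.Icc (-T) T, ‖u n t‖ ≤ V n := fun n t ht =>
    (le_supNorm (hu.continuous n) ht).trans (h.supNorm_le hR hu ha n)
  set v : ℝ → E := fun t => ∑' n, u n t with hv
  have hvs : ∀ t ∈ Set.Icc (-T) T, HasSum (fun n => u n t) (v t) := fun t ht =>
    (Summable.of_norm_bounded hV fun n => hb n t ht).hasSum
  have hvc : ContinuousOn v (Set.Icc (-T) T) :=
    continuousOn_tsum (fun n => (hu.continuous n).continuousOn) hV hb
  have hu0 : ∀ n, u (n + 1) 0 = 0 := fun n => by simp [hu.succ]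
  have hv0 : v 0 = a := by
    have : HasSum (fun n => u n 0) (u 0 0) := hasSum_single 0 fun n hn => by
      obtain ⟨m, rfl⟩ := Nat.exists_eq_succ_of_ne_zero hn
      exact hu0 m
    rw [hu.zero, flow_zero] at this
    exact this.tsum_eq
  -- Outside the interval nothing is known of the sum; a continuous extension makes the Duhamel
  -- integral differentiable at the endpoints too.
  set w : ℝ → E := Set.IccExtend hTT (fun t : Set.Icc (-T) T => v t) with hw
  have hwc : Continuous w := (continuousOn_iff_continuous_domRestrict.1 hvc).Icc_extend'
  have hwv : ∀ t ∈ Set.Icc (-T) T, w t = v t := fun t ht => Set.IccExtend_of_mem _ _ ht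
  have hNw : Continuous fun τ => N (w τ) (w τ) := (N.continuous.comp hwc).clm_apply hwc
  set g : ℝ → E := fun t => flow W t a - ε • ∫ τ in (0 : ℝ)..t, flow W (t - τ) (N (w τ) (w τ))
    with hg
  have hvg : ∀ t ∈ Set.Icc (-T) T, v t = g t := by
    intro t ht
    have hsub : ∀ τ ∈ Set.uIcc 0 t, τ ∈ Set.Icc (-T) T := fun τ hτ =>
      Set.uIcc_subset_Icc h0 ht hτ
    have hi := hasSum_integral_bilin_antidiagonal (W := W) (N := N) h.norm_flow_le hu.continuous hV
      (fun n τ hτ => hb n τ (hsub τ hτ)) (w := w) (fun τ hτ => hwv τ (hsub τ hτ))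
    have h1 : HasSum (fun n => u (n + 1) t)
        (-(ε • ∫ τ in (0 : ℝ)..t, flow W (t - τ) (N (w τ) (w τ)))) := by
      simp only [hu.succ]
      exact (hi.const_smul ε).neg
    have h2 := HasSum.zero_add (f := fun n => u n t) h1
    rw [hu.zero, ← sub_eq_add_neg] at h2
    exact (hvs t ht).unique h2
  refine ⟨hvc, hv0, fun t ht => ?_⟩
  have hd : HasDerivAt g (-(W (v t) + ε • N (v t) (v t))) t := by
    have h1 := ((hasDerivAt_flow W t).clm_apply (hasDerivAt_const t a)).sub
      ((hasDerivAt_integral_flow W hNw t).const_smul ε)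
    refine h1.congr_deriv ?_
    rw [← hwv t ht, show W (w t) = W (g t) by rw [hwv t ht, hvg t ht], hg]
    simp only [neg_apply, mul_apply_eq_comp, map_zero, add_zero, map_sub, map_smul, smul_add,
      smul_neg]
    abel
  exact (hd.hasDerivWithinAt).congr (fun τ hτ => hvg τ hτ) (hvg t ht)

theorem NormalForm.hasSum_tsum {T lam b κ R : ℝ} (h : NormalForm W N B T lam b κ)
    (hR : NormalForm.Small T b κ ε R) {u : ℕ → ℝ → E} (hu : IsDyson W N ε a u) (ha : ‖a‖ ≤ R)
    {t : ℝ} (ht : t ∈ Set.Icc (-T) T) :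
    HasSum (fun n => u n t) (∑' n, u n t) ∧ ∀ n, ‖u n t‖ ≤ (1 / 2) ^ n * R := by
  have hb : ∀ n, ‖u n t‖ ≤ (1 / 2) ^ n * R := fun n =>
    (le_supNorm (hu.continuous n) ht).trans (h.supNorm_le hR hu ha n)
  exact ⟨(Summable.of_norm_bounded ((summable_geometric_of_lt_one (by norm_num)
    (by norm_num)).mul_right R) hb).hasSum, hb⟩

theorem NormalForm.norm_tsum_sub_le {T lam b κ R : ℝ} (h : NormalForm W N B T lam b κ)
    (hR : NormalForm.Small T b κ ε R) {u u' : ℕ → ℝ → E} (hu : IsDyson W N ε a u)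
    (hu' : IsDyson W N ε a' u') (ha : ‖a‖ ≤ R) (ha' : ‖a'‖ ≤ R) {t : ℝ}
    (ht : t ∈ Set.Icc (-T) T) : ‖∑' n, u n t - ∑' n, u' n t‖ ≤ 2 * ‖a - a'‖ := by
  have h1 := (h.hasSum_tsum hR hu ha ht).1.sub (h.hasSum_tsum hR hu' ha' ht).1
  refine le_of_tendsto h1.tendsto_sum_nat.norm (Filter.Eventually.of_forall fun n => ?_)
  exact (norm_sum_le _ _).trans (h.sum_norm_sub_le hR hu hu' ha ha' ht n)

end WellPosed

/-! ### A Schur test for bilinear convolution operators -/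

section Kernel

theorem tsum_sq_le_of_sq_le_mul {ι : Type*} {t a b : ι → ℝ} (ht : ∀ i, 0 ≤ t i) (ha : ∀ i, 0 ≤ a i)
    (hb : ∀ i, 0 ≤ b i) (h : ∀ i, t i ^ 2 ≤ a i * b i) (hsa : Summable a) (hsb : Summable b) :
    Summable t ∧ (∑' i, t i) ^ 2 ≤ (∑' i, a i) * ∑' i, b i := by
  have hst : Summable t := by
    refine Summable.of_nonneg_of_le ht (fun i => ?_) (hsa.add hsb)
    refine abs_le_of_sq_le_sq' ((h i).trans ?_) (add_nonneg (ha i) (hb i)) |>.2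
    nlinarith [mul_nonneg (ha i) (hb i), sq_nonneg (a i), sq_nonneg (b i)]
  refine ⟨hst, le_of_tendsto (hst.hasSum.pow 2) (Filter.Eventually.of_forall fun s => ?_)⟩
  refine (Finset.sum_sq_le_sum_mul_sum_of_sq_le_mul s (fun i _ => ha i) (fun i _ => hb i)
    fun i _ => h i).trans ?_
  exact mul_le_mul (hsa.sum_le_tsum s fun i _ => ha i) (hsb.sum_le_tsum s fun i _ => hb i)
    (Finset.sum_nonneg fun i _ => hb i) (tsum_nonneg ha)

/-- The change of variables `(k, j) ↦ (j, k - j)`. -/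
def convEquiv : ℤ × ℤ ≃ ℤ × ℤ where
  toFun p := (p.2, p.1 - p.2)
  invFun p := (p.1 + p.2, p.1)
  left_inv p := by ext <;> simp
  right_inv p := by ext <;> simp

/-- A weighted `ℓ²` bound for a bilinear convolution operator with a symbol. -/
theorem kernel_bound {φ wx wy wz : ℤ → ℝ} {f g : ℤ → ℂ} {m : ℤ → ℤ → ℂ} {M : ℝ} (hM : 0 ≤ M)
    (hφ : ∀ k, 0 ≤ φ k) (hsφ : Summable φ) (hx : ∀ k, 0 ≤ wx k) (hy : ∀ k, 0 ≤ wy k)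
    (hz : ∀ k, 0 < wz k) (hf : Summable fun k => wx k * ‖f k‖ ^ 2)
    (hg : Summable fun k => wy k * ‖g k‖ ^ 2)
    (hm : ∀ j l, f j ≠ 0 → g l ≠ 0 →
      ‖m j l‖ ^ 2 * wz (j + l) ≤ M * (φ j + φ l) * (wx j * wy l)) :
    (∀ k, Summable fun j => m j (k - j) * (f j * g (k - j))) ∧
      (Summable fun k => wz k * ‖∑' j, m j (k - j) * (f j * g (k - j))‖ ^ 2) ∧
      ∑' k, wz k * ‖∑' j, m j (k - j) * (f j * g (k - j))‖ ^ 2 ≤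
        2 * M * (∑' k, φ k) * ((∑' k, wx k * ‖f k‖ ^ 2) * ∑' k, wy k * ‖g k‖ ^ 2) := by
  set F : ℤ → ℝ := fun k => wx k * ‖f k‖ ^ 2
  set G : ℤ → ℝ := fun k => wy k * ‖g k‖ ^ 2
  have hF : ∀ k, 0 ≤ F k := fun k => mul_nonneg (hx k) (sq_nonneg _)
  have hG : ∀ k, 0 ≤ G k := fun k => mul_nonneg (hy k) (sq_nonneg _)
  have hFG := hf.mul_of_nonneg hg hF hG
  have hFG' : Summable fun p : ℤ × ℤ => F p.2 * G (p.1 - p.2) := convEquiv.summable_iff.2 hFG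
  have hrow : ∀ k, Summable fun j => F j * G (k - j) := fun k => hFG'.prod_factor k
  have htot : HasSum (fun k => ∑' j, F j * G (k - j)) ((∑' k, F k) * ∑' k, G k) := by
    rw [hf.tsum_mul_tsum hg hFG, ← convEquiv.tsum_eq]
    exact hFG'.hasSum.prod_fiberwise fun k => (hrow k).hasSum
  have hφk : ∀ k, HasSum (fun j => φ j + φ (k - j)) (2 * ∑' k, φ k) := fun k => by
    rw [two_mul]
    exact hsφ.hasSum.add ((Equiv.subLeft k).hasSum_iff.2 hsφ.hasSum)
  have key : ∀ k, (Summable fun j => ‖m j (k - j) * (f j * g (k - j))‖) ∧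
      wz k * ‖∑' j, m j (k - j) * (f j * g (k - j))‖ ^ 2 ≤
        2 * M * (∑' k, φ k) * ∑' j, F j * G (k - j) := by
    intro k
    have hk := hz k
    -- Cauchy–Schwarz at fixed output frequency: one factor is the weight, whose sum over `j` does
    -- not depend on `k`; the other is `F j * G (k - j)`, whose sum over `k` and `j` factors.
    obtain ⟨h1, h2⟩ := tsum_sq_le_of_sq_le_mul
      (t := fun j => ‖m j (k - j) * (f j * g (k - j))‖)
      (a := fun j => M / wz k * (φ j + φ (k - j))) (b := fun j => F j * G (k - j))
      (fun j => norm_nonneg _)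
      (fun j => mul_nonneg (div_nonneg hM hk.le) (add_nonneg (hφ _) (hφ _)))
      (fun j => mul_nonneg (hF _) (hG _))
      (fun j => by
        have hr : 0 ≤ M / wz k * (φ j + φ (k - j)) * (F j * G (k - j)) :=
          mul_nonneg (mul_nonneg (div_nonneg hM hk.le) (add_nonneg (hφ _) (hφ _)))
            (mul_nonneg (hF _) (hG _))
        by_cases hfj : f j = 0
        · simpa [hfj] using hr
        by_cases hgj : g (k - j) = 0
        · simpa [hgj] using hr
        have h3 := hm j (k - j) hfj hgj
        rw [add_sub_cancel] at h3
        have h4 := mul_le_mul_of_nonneg_right h3 (sq_nonneg (‖f j‖ * ‖g (k - j)‖))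
        rw [norm_mul, norm_mul, div_mul_eq_mul_div, div_mul_eq_mul_div, le_div_iff₀ hk]
        calc _ = ‖m j (k - j)‖ ^ 2 * wz k * (‖f j‖ * ‖g (k - j)‖) ^ 2 := by ring
          _ ≤ _ := h4
          _ = _ := by simp only [F, G]; ring)
      ((hφk k).summable.mul_left _) (hrow k)
    refine ⟨h1, ?_⟩
    rw [tsum_mul_left, (hφk k).tsum_eq] at h2
    have h3 := pow_le_pow_left₀ (norm_nonneg _) (norm_tsum_le_tsum_norm h1) 2
    have h4 := mul_le_mul_of_nonneg_left (h3.trans h2) hk.le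
    refine h4.trans (le_of_eq ?_)
    field_simp
  have hs : Summable fun k => wz k * ‖∑' j, m j (k - j) * (f j * g (k - j))‖ ^ 2 :=
    Summable.of_nonneg_of_le (fun k => mul_nonneg (hz k).le (sq_nonneg _)) (fun k => (key k).2)
      (htot.summable.mul_left _)
  refine ⟨fun k => (key k).1.of_norm, hs, ?_⟩
  refine (hs.tsum_le_tsum (fun k => (key k).2) (htot.summable.mul_left _)).trans ?_
  rw [tsum_mul_left, htot.tsum_eq]

end Kernel

/-! ### The Japanese bracket and its Riemann sums -/

section Bracket

theorem bracket_sq (x : ℝ) : bracket x ^ 2 = 1 + x ^ 2 := Real.sq_sqrt (by positivity)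

theorem one_le_bracket (x : ℝ) : 1 ≤ bracket x := Real.one_le_sqrt.2 (by nlinarith [sq_nonneg x])

theorem bracket_pos (x : ℝ) : 0 < bracket x := zero_lt_one.trans_le (one_le_bracket x)

theorem bracket_add_le (x y : ℝ) : bracket (x + y) ≤ bracket x + bracket y := by
  refine abs_le_of_sq_le_sq' ?_ (add_pos (bracket_pos x) (bracket_pos y)).le |>.2
  have h : x * y ≤ bracket x * bracket y := by
    refine abs_le_of_sq_le_sq' ?_ (mul_pos (bracket_pos x) (bracket_pos y)).le |>.2
    rw [mul_pow, mul_pow, bracket_sq, bracket_sq]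
    nlinarith [sq_nonneg x, sq_nonneg y]
  rw [add_sq, bracket_sq, bracket_sq, bracket_sq]
  nlinarith

theorem bracket_add_le_mul (x y : ℝ) : bracket (x + y) ≤ 2 * (bracket x * bracket y) := by
  have h1 := bracket_add_le x y
  nlinarith [one_le_bracket x, one_le_bracket y]

theorem summable_bracket {p : ℝ} (hp : 1 < p) : Summable fun k : ℤ => bracket k ^ (-p) := by
  refine Summable.of_norm_bounded_eventually (Real.summable_abs_int_rpow hp) ?_
  refine (Set.finite_singleton (0 : ℤ)).subset fun k hk => ?_
  by_contra hk0
  refine hk ?_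
  have hk1 : (0 : ℝ) < |(k : ℝ)| := abs_pos.2 (by exact_mod_cast hk0)
  change ‖bracket k ^ (-p)‖ ≤ _
  rw [Real.norm_of_nonneg (Real.rpow_nonneg (bracket_pos _).le _)]
  refine Real.rpow_le_rpow_of_nonpos hk1 ?_ (by linarith)
  exact Real.abs_le_sqrt (by linarith)

theorem bracket_le_two_mul {x y : ℝ} (h : |x - y| ≤ 1) : bracket x ≤ 2 * bracket y := by
  refine abs_le_of_sq_le_sq' ?_ (by linarith [bracket_pos y]) |>.2
  rw [mul_pow, bracket_sq, bracket_sq]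
  have h1 : (x - y) ^ 2 ≤ 1 := by rw [← sq_abs]; exact pow_le_one₀ (abs_nonneg _) h
  nlinarith [sq_nonneg (x - 2 * y)]

/-- A Riemann sum bound, uniform in the length of the torus. -/
theorem summable_bracket_div {p L : ℝ} (hp : 1 < p) (hL : 1 ≤ L) :
    (Summable fun k : ℤ => bracket (k / L) ^ (-p)) ∧
      ∑' k : ℤ, bracket (k / L) ^ (-p) ≤ 2 ^ p * (∑' k : ℤ, bracket k ^ (-p)) * (2 * L) := by
  -- Write `k = qm + r` with `0 ≤ r < m`. Then `k / m` is within `1` of `q`, so `⟨q⟩ ≤ 2⟨k/m⟩ ≤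
  -- 2⟨k/L⟩`, and each `q` occurs `m ≤ 2L` times.
  set m : ℕ := ⌈L⌉₊ with hm
  have hLm : L ≤ m := Nat.le_ceil L
  have hmL : (m : ℝ) ≤ 2 * L := by linarith [Nat.ceil_lt_add_one (zero_le_one.trans hL)]
  have hm0 : (0 : ℝ) < m := by linarith
  have : NeZero m := ⟨by exact_mod_cast hm0.ne'⟩
  have hle : ∀ p' : ℤ × Fin m, bracket (((Int.divModEquiv m).symm p' : ℤ) / L) ^ (-p) ≤
      2 ^ p * bracket p'.1 ^ (-p) * 1 := by
    rintro ⟨q, r⟩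
    have h1 : ((Int.divModEquiv m).symm (q, r) : ℤ) = q * m + (r : ℕ) := rfl
    set k : ℤ := (Int.divModEquiv m).symm (q, r) with hk
    have hr : ((r : ℕ) : ℝ) ≤ m := by exact_mod_cast r.2.le
    have h2 : (k : ℝ) / m = q + (r : ℕ) / m := by
      rw [h1]; push_cast; field_simp
    have h3 : bracket q ≤ 2 * bracket (k / m) := by
      refine bracket_le_two_mul ?_
      rw [h2, sub_add_cancel_left, abs_neg, abs_of_nonneg (by positivity)]
      exact (div_le_one hm0).2 hr
    have h4 : bracket (k / m) ≤ bracket (k / L) := by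
      refine Real.sqrt_le_sqrt ?_
      rw [div_pow, div_pow]
      gcongr
    have h5 : bracket q / 2 ≤ bracket (k / L) := by linarith
    have h6 : 0 < bracket q / 2 := half_pos (bracket_pos _)
    calc bracket (k / L) ^ (-p) ≤ (bracket q / 2) ^ (-p) :=
          Real.rpow_le_rpow_of_nonpos h6 h5 (by linarith)
      _ = _ := by
          rw [Real.div_rpow (bracket_pos _).le two_pos.le, Real.rpow_neg two_pos.le]
          field_simp
  have hA := (summable_bracket hp).mul_left (2 ^ p)
  have hAn : ∀ k : ℤ, 0 ≤ (2 : ℝ) ^ p * bracket k ^ (-p) := fun k =>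
    mul_nonneg (by positivity) (Real.rpow_nonneg (bracket_pos _).le _)
  have h1s : Summable fun _ : Fin m => (1 : ℝ) := Summable.of_finite
  have hprod := hA.mul_of_nonneg h1s hAn fun _ => zero_le_one
  have hs : Summable fun p' : ℤ × Fin m => bracket (((Int.divModEquiv m).symm p' : ℤ) / L) ^ (-p) :=
    Summable.of_nonneg_of_le (fun _ => Real.rpow_nonneg (bracket_pos _).le _) hle hprod
  refine ⟨(Int.divModEquiv m).symm.summable_iff.1 hs, ?_⟩
  rw [← (Int.divModEquiv m).symm.tsum_eq]
  refine (hs.tsum_le_tsum hle hprod).trans ?_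
  rw [← hA.tsum_mul_tsum h1s hprod, tsum_mul_left,
    show ∑' _ : Fin m, (1 : ℝ) = m by simp]
  exact mul_le_mul_of_nonneg_left hmL (mul_nonneg (by positivity)
    (tsum_nonneg fun k => Real.rpow_nonneg (bracket_pos _).le _))

end Bracket

/-! ### Pointwise bounds on the symbol of the normal form -/

section Symbols

/-- The resonance function of the quadratic interaction of the frequencies `x` and `y`. -/
noncomputable def resonance (x y : ℝ) : ℝ := omega (x + y) - omega x - omega y

/-- The symbol of the normal form. -/
noncomputable def nfSymbol (lam x y : ℝ) : ℂ :=
  Complex.I * (omega (x + y) : ℂ) / (Complex.I * (resonance x y : ℂ) + (lam : ℂ))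

theorem resonance_eq (x y : ℝ) : resonance x y =
    -(x * y * (x + y) * (x ^ 2 + x * y + y ^ 2 + 3)) /
      ((1 + x ^ 2) * (1 + y ^ 2) * (1 + (x + y) ^ 2)) := by
  have h1 : 1 + x ^ 2 ≠ 0 := by positivity
  have h2 : 1 + y ^ 2 ≠ 0 := by positivity
  have h3 : 1 + (x + y) ^ 2 ≠ 0 := by positivity
  rw [resonance, omega, omega, omega]
  field_simp
  ring

theorem resonance_comm (x y : ℝ) : resonance x y = resonance y x := by
  rw [resonance, resonance, add_comm x y]
  ring

theorem nfSymbol_comm (lam x y : ℝ) : nfSymbol lam x y = nfSymbol lam y x := by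
  rw [nfSymbol, nfSymbol, resonance_comm, add_comm x y]

theorem abs_omega_mul_bracket_le (x : ℝ) : |omega x| * bracket x ≤ 1 := by
  have h1 : 0 < 1 + x ^ 2 := by positivity
  have h2 : |x| ≤ bracket x := Real.abs_le_sqrt (by linarith)
  rw [omega, abs_div, abs_of_pos h1, div_mul_eq_mul_div, div_le_one h1, ← bracket_sq, sq]
  exact mul_le_mul_of_nonneg_right h2 (bracket_pos x).le

theorem abs_omega_le_one (x : ℝ) : |omega x| ≤ 1 :=
  (le_mul_of_one_le_right (abs_nonneg _) (one_le_bracket x)).trans (abs_omega_mul_bracket_le x)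

/-- The factor `(x + y) / (1 + (x + y)²)` is common to `ω(x + y)` and the resonance function and
cancels, which leaves a polynomial inequality. -/
theorem abs_omega_add_mul_le {x y c d : ℝ}
    (h : (1 + x ^ 2) * (1 + y ^ 2) * d ≤ c * (|x| * |y| * (x ^ 2 + x * y + y ^ 2 + 3))) :
    |omega (x + y)| * d ≤ c * |resonance x y| := by
  have hQ : 0 ≤ x ^ 2 + x * y + y ^ 2 + 3 := by nlinarith [sq_nonneg (x + y)]
  have h1 : 0 < 1 + x ^ 2 := by positivity
  have h2 : 0 < 1 + y ^ 2 := by positivity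
  have h3 : 0 < 1 + (x + y) ^ 2 := by positivity
  rw [resonance_eq, omega, abs_div, abs_div, abs_neg, abs_mul, abs_mul, abs_mul, abs_of_nonneg hQ,
    abs_of_pos h3, abs_of_pos (mul_pos (mul_pos h1 h2) h3), div_mul_eq_mul_div, mul_div_assoc',
    div_le_div_iff₀ h3 (mul_pos (mul_pos h1 h2) h3)]
  have h4 := mul_le_mul_of_nonneg_left h (mul_nonneg (abs_nonneg (x + y)) h3.le)
  calc _ = |x + y| * (1 + (x + y) ^ 2) * ((1 + x ^ 2) * (1 + y ^ 2) * d) := by ring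
    _ ≤ _ := h4
    _ = _ := by ring

theorem one_add_sq_le {l x : ℝ} (hx : 1 ≤ l * |x|) (hl : 1 ≤ l) :
    1 + x ^ 2 ≤ 2 * (l * |x|) ^ 2 := by
  have h1 : 1 ≤ (l * |x|) ^ 2 := one_le_pow₀ hx
  have h2 : |x| ^ 2 ≤ (l * |x|) ^ 2 :=
    pow_le_pow_left₀ (abs_nonneg x) (le_mul_of_one_le_left (abs_nonneg x) hl) 2
  rw [sq_abs] at h2
  linarith

/-- Here `(1 + x²)(1 + y²)` is bounded both by `4l⁴x²y²` and by the square of `x² + xy + y² + 3`;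
the claim is the geometric mean of the two bounds. -/
theorem abs_omega_add_le {l x y : ℝ} (hx : 1 ≤ l * |x|) (hy : 1 ≤ l * |y|) (hl : 1 ≤ l) :
    |omega (x + y)| ≤ 2 * l ^ 2 * |resonance x y| := by
  have hQ : 0 ≤ x ^ 2 + x * y + y ^ 2 + 3 := by nlinarith [sq_nonneg (x + y)]
  rw [← mul_one |omega _|]
  refine abs_omega_add_mul_le ?_
  rw [mul_one]
  have h1 := one_add_sq_le hx hl
  have h2 := one_add_sq_le hy hl
  refine abs_le_of_sq_le_sq' ?_ (by positivity) |>.2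
  have h3 : (1 + x ^ 2) * (1 + y ^ 2) ≤ (2 * (l * |x|) ^ 2) * (2 * (l * |y|) ^ 2) := by gcongr
  have h4 : (1 + x ^ 2) * (1 + y ^ 2) ≤ (x ^ 2 + x * y + y ^ 2 + 3) ^ 2 := by
    have h5 : (1 + x ^ 2 + (1 + y ^ 2)) / 2 ≤ x ^ 2 + x * y + y ^ 2 + 3 := by
      nlinarith [sq_nonneg (x + y)]
    have h6 := pow_le_pow_left₀ (by positivity) h5 2
    nlinarith [sq_nonneg (x ^ 2 - y ^ 2)]
  calc ((1 + x ^ 2) * (1 + y ^ 2)) ^ 2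
      ≤ ((2 * (l * |x|) ^ 2) * (2 * (l * |y|) ^ 2)) * (x ^ 2 + x * y + y ^ 2 + 3) ^ 2 := by
        rw [sq]
        exact mul_le_mul h3 h4 (by positivity) (by positivity)
    _ = _ := by ring

/-- The extra `ω(x)` absorbs `1 + x²` and leaves `|x|`. Of the two factors `⟨y⟩` one is at most
`2l|y|`, while the other, times `⟨x⟩ + ⟨y⟩`, is dominated by the quadratic form. So a full
derivative is gained in both variables. -/
theorem abs_omega_add_mul_omega_le {l x y : ℝ} (hx : x ≠ 0) (hy : 1 ≤ l * |y|) (hl : 1 ≤ l) :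
    |omega (x + y)| * (|omega x| * (bracket x + bracket y)) ≤ 6 * l * |resonance x y| := by
  refine abs_omega_add_mul_le ?_
  have hX : 0 < 1 + x ^ 2 := by positivity
  have hx0 := abs_pos.2 hx
  have hJx := bracket_pos x
  have hJy := bracket_pos y
  have h1 : bracket y ≤ 2 * (l * |y|) := by
    refine abs_le_of_sq_le_sq' ?_ (by positivity) |>.2
    rw [bracket_sq]
    nlinarith [one_add_sq_le hy hl, sq_nonneg (l * |y|)]
  have h2 : bracket y * (bracket x + bracket y) ≤ 3 * (x ^ 2 + x * y + y ^ 2 + 3) := by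
    have h3 := bracket_sq x
    have h4 := bracket_sq y
    nlinarith [sq_nonneg (x + y), sq_nonneg (bracket x - bracket y), sq_nonneg x, sq_nonneg y]
  have h0 : (1 + x ^ 2) * |omega x| = |x| := by
    rw [omega, abs_div, abs_of_pos hX]
    field_simp
  have h5 : bracket y * (bracket y * (bracket x + bracket y)) ≤
      2 * (l * |y|) * (3 * (x ^ 2 + x * y + y ^ 2 + 3)) :=
    mul_le_mul h1 h2 (by positivity) (by positivity)
  calc (1 + x ^ 2) * (1 + y ^ 2) * (|omega x| * (bracket x + bracket y))
      = ((1 + x ^ 2) * |omega x|) * (bracket y ^ 2 * (bracket x + bracket y)) := by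
        rw [bracket_sq y]; ring
    _ = |x| * (bracket y * (bracket y * (bracket x + bracket y))) := by rw [h0]; ring
    _ ≤ |x| * (2 * (l * |y|) * (3 * (x ^ 2 + x * y + y ^ 2 + 3))) := by gcongr
    _ = _ := by ring

theorem norm_sq_denominator (lam r : ℝ) :
    ‖Complex.I * (r : ℂ) + (lam : ℂ)‖ ^ 2 = lam ^ 2 + r ^ 2 := by
  rw [Complex.sq_norm, Complex.normSq_apply]
  simp
  ring

theorem norm_sq_nfSymbol (lam x y : ℝ) :
    ‖nfSymbol lam x y‖ ^ 2 = omega (x + y) ^ 2 / (lam ^ 2 + resonance x y ^ 2) := by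
  rw [nfSymbol, norm_div, div_pow, norm_sq_denominator, norm_mul, Complex.norm_I, one_mul,
    Complex.norm_real, Real.norm_eq_abs, sq_abs]

/-- The denominator has modulus at least that of the resonance function, so bounds on the
unregularised quotient survive, with no dependence on `lam`. -/
theorem norm_nfSymbol_mul_le {lam x y c d : ℝ} (hl : 0 < lam) (hc : 0 ≤ c)
    (h : |omega (x + y)| * d ≤ c * |resonance x y|) : ‖nfSymbol lam x y‖ * d ≤ c := by
  by_cases hd : d ≤ 0
  · exact (mul_nonpos_of_nonneg_of_nonpos (norm_nonneg _) hd).trans hc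
  push Not at hd
  refine abs_le_of_sq_le_sq' ?_ hc |>.2
  rw [mul_pow, norm_sq_nfSymbol, div_mul_eq_mul_div, div_le_iff₀ (by positivity), ← mul_pow,
    ← sq_abs, abs_mul, abs_of_pos hd]
  have h1 := pow_le_pow_left₀ (by positivity) h 2
  rw [mul_pow c, sq_abs] at h1
  nlinarith [mul_nonneg (sq_nonneg c) (sq_nonneg lam)]

/-- The half derivative gained from the regularisation: `ω(x+y)² ⟨x+y⟩ ≤ |ω(x+y)| ≤ 2|Ω|`, while `λ²
+ Ω² ≥ 2λ|Ω|`. -/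
theorem norm_sq_nfSymbol_mul_bracket_le {lam x y : ℝ} (hl : 0 < lam) (hx : 1 ≤ |x|)
    (hy : 1 ≤ |y|) : ‖nfSymbol lam x y‖ ^ 2 * bracket (x + y) ≤ lam⁻¹ := by
  have h1 := abs_omega_add_le (l := 1) (by simpa using hx) (by simpa using hy) le_rfl
  have h2 := abs_omega_mul_bracket_le (x + y)
  have h3 : |omega (x + y)| ^ 2 * bracket (x + y) ≤ 2 * |resonance x y| := by
    calc _ = |omega (x + y)| * (|omega (x + y)| * bracket (x + y)) := by ring
      _ ≤ |omega (x + y)| * 1 := by gcongr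
      _ ≤ _ := by linarith
  have h4 : 2 * lam * |resonance x y| ≤ lam ^ 2 + resonance x y ^ 2 := by
    have := sq_abs (resonance x y)
    nlinarith [sq_nonneg (lam - |resonance x y|)]
  rw [norm_sq_nfSymbol, div_mul_eq_mul_div, div_le_iff₀ (by positivity), ← sq_abs (omega _)]
  refine h3.trans ?_
  rw [inv_mul_eq_div, le_div_iff₀ hl]
  linarith

theorem bracket_rpow_two_mul (x σ : ℝ) : bracket x ^ (2 * σ) = (bracket x ^ 2) ^ σ := by
  rw [Real.rpow_mul (bracket_pos x).le]
  norm_num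

/-- With `a = ⟨x⟩^{2σ}` and `b = ⟨y⟩^{2σ}` this is `b/a + a/b ≥ 2`. It lets an absolute constant be
paid for by the Schur weights. -/
theorem two_le_sum_bracket_mul (x y σ : ℝ) :
    2 ≤ (bracket x ^ (-(4 * σ)) + bracket y ^ (-(4 * σ))) *
      (bracket x ^ (2 * σ) * bracket y ^ (2 * σ)) := by
  have ha : 0 < bracket x ^ (2 * σ) := Real.rpow_pos_of_pos (bracket_pos x) _
  have hb : 0 < bracket y ^ (2 * σ) := Real.rpow_pos_of_pos (bracket_pos y) _
  have h : ∀ z, bracket z ^ (-(4 * σ)) = ((bracket z ^ (2 * σ)) ^ 2)⁻¹ := fun z => by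
    rw [← Real.rpow_natCast, ← Real.rpow_mul (bracket_pos z).le, ← Real.rpow_neg (bracket_pos z).le]
    congr 1
    push_cast
    ring
  rw [h, h]
  set a := bracket x ^ (2 * σ)
  set b := bracket y ^ (2 * σ)
  rw [inv_add_inv (by positivity) (by positivity), div_mul_eq_mul_div, le_div_iff₀ (by positivity)]
  nlinarith [mul_nonneg (mul_pos ha hb).le (sq_nonneg (a - b))]

/-- The normal form, on frequencies that do not vanish. -/
theorem norm_sq_nfSymbol_le {σ lam L x y : ℝ} (hl : 0 < lam) (hL : 1 ≤ L) (hσ0 : 0 ≤ σ)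
    (hσ : σ ≤ 1 / 2) (hx : 1 ≤ L * |x|) (hy : 1 ≤ L * |y|) :
    ‖nfSymbol lam x y‖ ^ 2 * bracket (x + y) ^ (2 * σ) ≤
      (16 * L ^ 4 + lam⁻¹) * (bracket x ^ (-(4 * σ)) + bracket y ^ (-(4 * σ))) *
        (bracket x ^ (2 * σ) * bracket y ^ (2 * σ)) := by
  have hA := two_le_sum_bracket_mul x y σ
  have hl' : 0 < lam⁻¹ := inv_pos.2 hl
  have hJ : ∀ z p : ℝ, 0 < bracket z ^ p := fun z p => Real.rpow_pos_of_pos (bracket_pos z) p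
  -- If both frequencies are high, the half derivative covers `⟨x+y⟩^{2σ}`, as `2σ ≤ 1`. Otherwise
  -- one Schur weight is at least `1/2`, and the bound `2L²` on the symbol suffices.
  by_cases h : 1 ≤ |x| ∧ 1 ≤ |y|
  · have h1 := norm_sq_nfSymbol_mul_bracket_le hl h.1 h.2
    have h2 : bracket (x + y) ^ (2 * σ) ≤ bracket (x + y) := by
      conv_rhs => rw [← Real.rpow_one (bracket (x + y))]
      exact Real.rpow_le_rpow_of_exponent_le (one_le_bracket _) (by linarith)
    calc _ ≤ ‖nfSymbol lam x y‖ ^ 2 * bracket (x + y) := by gcongr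
      _ ≤ lam⁻¹ := h1
      _ ≤ (16 * L ^ 4 + lam⁻¹) * 2 := by nlinarith [pow_pos (zero_lt_one.trans_le hL) 4]
      _ ≤ (16 * L ^ 4 + lam⁻¹) * _ := mul_le_mul_of_nonneg_left hA (by positivity)
      _ = _ := by ring
  · have h1 : ‖nfSymbol lam x y‖ * 1 ≤ 2 * L ^ 2 :=
      norm_nfSymbol_mul_le hl (by positivity) (by rw [mul_one]; exact abs_omega_add_le hx hy hL)
    rw [mul_one] at h1
    have h2 : bracket (x + y) ^ (2 * σ) ≤ 2 * (bracket x ^ (2 * σ) * bracket y ^ (2 * σ)) := by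
      have h3 : bracket (x + y) ^ 2 ≤ 2 * (bracket x ^ 2 * bracket y ^ 2) := by
        rw [bracket_sq, bracket_sq, bracket_sq]
        nlinarith [sq_nonneg (x - y), sq_nonneg (x * y)]
      have h4 : (2 : ℝ) ^ σ ≤ 2 := by
        conv_rhs => rw [← Real.rpow_one 2]
        exact Real.rpow_le_rpow_of_exponent_le one_le_two (by linarith)
      rw [bracket_rpow_two_mul, bracket_rpow_two_mul x, bracket_rpow_two_mul y]
      refine (Real.rpow_le_rpow (by positivity) h3 hσ0).trans ?_
      rw [Real.mul_rpow two_pos.le (by positivity), Real.mul_rpow (by positivity) (by positivity)]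
      have := bracket_pos x
      have := bracket_pos y
      gcongr
    have h5 : ∀ z : ℝ, |z| < 1 → 1 / 2 ≤ bracket z ^ (-(4 * σ)) := fun z hz => by
      have h6 : bracket z ^ 2 ≤ 2 := by
        rw [bracket_sq, ← sq_abs]
        nlinarith [abs_nonneg z]
      have h7 : bracket z ^ (4 * σ) ≤ 2 := by
        rw [show 4 * σ = 2 * (2 * σ) by ring, bracket_rpow_two_mul]
        refine (Real.rpow_le_rpow (sq_nonneg _) h6 (by linarith)).trans ?_
        conv_rhs => rw [← Real.rpow_one 2]
        exact Real.rpow_le_rpow_of_exponent_le one_le_two (by linarith)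
      rw [Real.rpow_neg (bracket_pos z).le, one_div]
      exact inv_anti₀ (hJ _ _) h7
    have h6 : 1 / 2 ≤ bracket x ^ (-(4 * σ)) + bracket y ^ (-(4 * σ)) := by
      have h7 := (hJ x (-(4 * σ))).le
      have h8 := (hJ y (-(4 * σ))).le
      rcases not_and_or.1 h with h | h
      · linarith [h5 x (not_le.1 h)]
      · linarith [h5 y (not_le.1 h)]
    have hp : 0 < bracket x ^ (2 * σ) * bracket y ^ (2 * σ) := mul_pos (hJ _ _) (hJ _ _)
    calc _ ≤ (2 * L ^ 2) ^ 2 * (2 * (bracket x ^ (2 * σ) * bracket y ^ (2 * σ))) :=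
          mul_le_mul (pow_le_pow_left₀ (norm_nonneg _) h1 2) h2 (hJ _ _).le (by positivity)
      _ = 16 * L ^ 4 * (1 / 2) * (bracket x ^ (2 * σ) * bracket y ^ (2 * σ)) := by ring
      _ ≤ (16 * L ^ 4 + lam⁻¹) * (bracket x ^ (-(4 * σ)) + bracket y ^ (-(4 * σ))) *
          (bracket x ^ (2 * σ) * bracket y ^ (2 * σ)) := by gcongr; linarith

/-- The normal form, applied after the derivative loss of the nonlinearity. -/
theorem norm_sq_nfSymbol_mul_omega_le {σ lam L x y : ℝ} (hl : 0 < lam) (hL : 1 ≤ L) (hσ0 : 0 ≤ σ)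
    (hσ : σ ≤ 1 / 2) (hx : x ≠ 0) (hy : 1 ≤ L * |y|) :
    ‖nfSymbol lam x y * (Complex.I * (omega x : ℂ))‖ ^ 2 * bracket (x + y) ^ (2 * σ) ≤
      36 * L ^ 2 * bracket y ^ (-(4 * σ)) * bracket y ^ (2 * σ) := by
  have hJx := bracket_pos x
  have hJy := bracket_pos y
  have h1 := norm_nfSymbol_mul_le hl (by positivity) (abs_omega_add_mul_omega_le hx hy hL)
  -- Since `2σ ≤ 1`, the full derivative gained pays for the output weight and for a factor
  -- `⟨y⟩^{2σ}`. No weight on `x` is left, so the first argument need only be in `L²` at the base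
  -- regularity.
  have h2 : bracket (x + y) ^ (2 * σ) ≤
      (bracket x + bracket y) ^ 2 * bracket y ^ (-(2 * σ)) := by
    rw [Real.rpow_neg hJy.le, ← div_eq_mul_inv, le_div_iff₀ (by positivity),
      ← Real.mul_rpow (bracket_pos _).le hJy.le]
    have h3 : bracket (x + y) * bracket y ≤ (bracket x + bracket y) ^ 2 := by
      have := bracket_add_le x y
      nlinarith
    have h4 : 1 ≤ (bracket x + bracket y) ^ 2 := by
      nlinarith [one_le_bracket x, one_le_bracket y]
    refine (Real.rpow_le_rpow (mul_pos (bracket_pos _) hJy).le h3 (by linarith)).trans ?_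
    conv_rhs => rw [← Real.rpow_one ((bracket x + bracket y) ^ 2)]
    exact Real.rpow_le_rpow_of_exponent_le h4 (by linarith)
  have h5 : bracket y ^ (-(4 * σ)) * bracket y ^ (2 * σ) = bracket y ^ (-(2 * σ)) := by
    rw [← Real.rpow_add hJy]
    ring_nf
  rw [mul_assoc, h5, norm_mul, norm_mul, Complex.norm_I, one_mul, Complex.norm_real,
    Real.norm_eq_abs]
  have h6 := pow_le_pow_left₀ (by positivity) h1 2
  calc (‖nfSymbol lam x y‖ * |omega x|) ^ 2 * bracket (x + y) ^ (2 * σ)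
      ≤ (‖nfSymbol lam x y‖ * |omega x|) ^ 2 *
          ((bracket x + bracket y) ^ 2 * bracket y ^ (-(2 * σ))) := by gcongr
    _ = (‖nfSymbol lam x y‖ * (|omega x| * (bracket x + bracket y))) ^ 2 *
          bracket y ^ (-(2 * σ)) := by ring
    _ ≤ (6 * L) ^ 2 * bracket y ^ (-(2 * σ)) := by gcongr
    _ = _ := by ring

theorem bracket_add_rpow_le {r : ℝ} (hr : 0 ≤ r) (x y : ℝ) :
    bracket (x + y) ^ (2 * r) ≤ 2 ^ (2 * r) * (bracket x ^ (2 * r) * bracket y ^ (2 * r)) := by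
  rw [← Real.mul_rpow (bracket_pos x).le (bracket_pos y).le,
    ← Real.mul_rpow two_pos.le (mul_pos (bracket_pos x) (bracket_pos y)).le]
  exact Real.rpow_le_rpow (bracket_pos _).le (bracket_add_le_mul x y) (by linarith)

end Symbols

/-! ### `W`, `S(t)` and Fourier coefficients as bounded operators on `H^s` -/

section Operators

variable {L : ℝ} [hL : Fact (0 < L)] {s : ℝ}

theorem Hs.norm_sq (u : Hs L s) :
    ‖u‖ ^ 2 = ∑' k : ℤ, bracket (k / L) ^ (2 * s) * ‖hat L u k‖ ^ 2 := by
  rw [Hs.norm_def, Real.sq_sqrt]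
  exact tsum_nonneg fun k => mul_nonneg (Real.rpow_nonneg (bracket_pos _).le _) (sq_nonneg _)

theorem Hs.summable (u : Hs L s) :
    Summable fun k : ℤ => bracket (k / L) ^ (2 * s) * ‖hat L u k‖ ^ 2 :=
  (show sobolevSubmodule L s from u).2.2

theorem Hs.hat_zero_freq (u : Hs L s) : hat L u 0 = 0 := (show sobolevSubmodule L s from u).2.1

theorem Hs.hat_real_smul (c : ℝ) (u : Hs L s) (k : ℤ) :
    hat L (c • u : Hs L s) k = (c : ℂ) * hat L u k := Hs.hat_smul (c : ℂ) u k

theorem Hs.hat_sub (u v : Hs L s) (k : ℤ) : hat L (u - v : Hs L s) k = hat L u k - hat L v k := by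
  have h1 := Hs.hat_add u ((-1 : ℂ) • v) k
  rw [Hs.hat_smul, neg_one_smul, ← sub_eq_add_neg] at h1
  rw [h1]
  ring

theorem exists_Hs (hs : 0 ≤ s) (c : ℤ → ℂ) (h0 : c 0 = 0)
    (hc : Summable fun k : ℤ => bracket (k / L) ^ (2 * s) * ‖c k‖ ^ 2) :
    ∃ u : Hs L s, ∀ k, hat L u k = c k := by
  have hmem : Memℓp c 2 := by
    rw [memℓp_gen_iff (by norm_num)]
    refine Summable.of_nonneg_of_le (fun k => Real.rpow_nonneg (norm_nonneg _) _)
      (fun k => ?_) hc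
    have h1 : 1 ≤ bracket ((k : ℝ) / L) ^ (2 * s) :=
      Real.one_le_rpow (one_le_bracket _) (by linarith)
    have h2 : ‖c k‖ ^ (ENNReal.toReal 2) = ‖c k‖ ^ 2 := by norm_num
    rw [h2]
    exact le_mul_of_one_le_left (sq_nonneg _) h1
  obtain ⟨f, hf⟩ := exists_hat_eq (L := L) c hmem
  refine ⟨(⟨f, (hf 0).trans h0, ?_⟩ : sobolevSubmodule L s), hf⟩
  simpa only [hf] using hc

theorem hat_multiplier {m : ℝ → ℂ} {f : Torus L → ℂ}
    (h : ∃ v : Hs L s, ∀ k : ℤ, hat L v k = m (k / L) * hat L f k) (k : ℤ) :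
    hat L (multiplier L s m f) k = m (k / L) * hat L f k := by
  rw [multiplier, dif_pos h]
  exact h.choose_spec k

theorem multiplier_eq {m : ℝ → ℂ} {f : Torus L → ℂ} {v : Hs L s}
    (h : ∀ k : ℤ, hat L v k = m (k / L) * hat L f k) : multiplier L s m f = v :=
  Hs.ext_hat fun k => by rw [hat_multiplier ⟨v, h⟩, h]

theorem summable_mul_hat {c : ℤ → ℂ} (hc : ∀ k, ‖c k‖ ≤ 1) (u : Hs L s) :
    Summable fun k : ℤ => bracket (k / L) ^ (2 * s) * ‖c k * hat L u k‖ ^ 2 := by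
  refine Summable.of_nonneg_of_le
    (fun k => mul_nonneg (Real.rpow_nonneg (bracket_pos _).le _) (sq_nonneg _)) (fun k => ?_)
    u.summable
  refine mul_le_mul_of_nonneg_left ?_ (Real.rpow_nonneg (bracket_pos _).le _)
  rw [norm_mul]
  exact pow_le_pow_left₀ (by positivity) (mul_le_of_le_one_left (norm_nonneg _) (hc k)) 2

theorem Hs.norm_le_of_hat {u v : Hs L s} (h : ∀ k, ‖hat L u k‖ ≤ ‖hat L v k‖) : ‖u‖ ≤ ‖v‖ := by
  rw [Hs.norm_def, Hs.norm_def]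
  refine Real.sqrt_le_sqrt (u.summable.tsum_le_tsum (fun k => ?_) v.summable)
  exact mul_le_mul_of_nonneg_left (pow_le_pow_left₀ (norm_nonneg _) (h k) 2)
    (Real.rpow_nonneg (bracket_pos _).le _)

theorem norm_I_mul_omega_le (x : ℝ) : ‖Complex.I * (omega x : ℂ)‖ ≤ 1 := by
  rw [norm_mul, Complex.norm_I, one_mul, Complex.norm_real]
  exact abs_omega_le_one x

theorem hat_W (hs : 0 ≤ s) (u : Hs L s) (k : ℤ) :
    hat L (W L s u) k = Complex.I * (omega (k / L) : ℂ) * hat L u k :=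
  hat_multiplier (m := fun ξ => Complex.I * (omega ξ : ℂ))
    (exists_Hs hs (fun k : ℤ => Complex.I * (omega (k / L) : ℂ) * hat L u k)
    (by rw [u.hat_zero_freq, mul_zero]) (summable_mul_hat (fun k => norm_I_mul_omega_le _) u)) k

/-- `W` as a bounded operator on `H^s`. -/
noncomputable def WCLM (L : ℝ) [Fact (0 < L)] {s : ℝ} (hs : 0 ≤ s) : Hs L s →L[ℝ] Hs L s :=
  LinearMap.mkContinuous
    { toFun := fun u => W L s u
      map_add' := fun u v => Hs.ext_hat fun k => by
        simp only [Hs.hat_add, hat_W hs, mul_add]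
      map_smul' := fun c u => Hs.ext_hat fun k => by
        simp only [Hs.hat_real_smul, hat_W hs, RingHom.id_apply]
        ring } 1 fun u => by
    rw [one_mul]
    refine Hs.norm_le_of_hat fun k => ?_
    change ‖hat L (W L s u) k‖ ≤ _
    rw [hat_W hs, norm_mul]
    exact mul_le_of_le_one_left (norm_nonneg _) (norm_I_mul_omega_le _)

theorem WCLM_apply (hs : 0 ≤ s) (u : Hs L s) : WCLM L hs u = W L s u := rfl

theorem Hs.norm_hat_le (hs : 0 ≤ s) (u : Hs L s) (k : ℤ) : ‖hat L u k‖ ≤ ‖u‖ := by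
  refine abs_le_of_sq_le_sq' ?_ (norm_nonneg _) |>.2
  rw [Hs.norm_sq]
  have h1 := u.summable.le_tsum k fun j _ =>
    mul_nonneg (Real.rpow_nonneg (bracket_pos _).le _) (sq_nonneg _)
  exact (le_mul_of_one_le_left (sq_nonneg _)
    (Real.one_le_rpow (one_le_bracket _) (by linarith))).trans h1

/-- A Fourier coefficient as a bounded functional on `H^s`. -/
noncomputable def hatCLM (L : ℝ) [Fact (0 < L)] {s : ℝ} (hs : 0 ≤ s) (k : ℤ) : Hs L s →L[ℝ] ℂ :=
  LinearMap.mkContinuous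
    { toFun := fun u => hat L u k
      map_add' := fun u v => Hs.hat_add u v k
      map_smul' := fun c u => Hs.hat_real_smul c u k } 1 fun u => by
    rw [one_mul]
    exact u.norm_hat_le hs k

theorem norm_exp_omega (t x : ℝ) :
    ‖Complex.exp (-(Complex.I * (t : ℂ) * (omega x : ℂ)))‖ = 1 := by
  have h : -(Complex.I * (t : ℂ) * (omega x : ℂ)) = ((-(t * omega x) : ℝ) : ℂ) * Complex.I := by
    push_cast
    ring
  rw [h, Complex.norm_exp_ofReal_mul_I]

theorem hat_S (hs : 0 ≤ s) (t : ℝ) (u : Hs L s) (k : ℤ) :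
    hat L (S L s t u) k =
      Complex.exp (-(Complex.I * (t : ℂ) * (omega (k / L) : ℂ))) * hat L u k :=
  hat_multiplier (m := fun ξ => Complex.exp (-(Complex.I * (t : ℂ) * (omega ξ : ℂ))))
    (exists_Hs hs (fun k : ℤ => Complex.exp (-(Complex.I * (t : ℂ) * (omega (k / L) : ℂ))) *
      hat L u k) (by rw [u.hat_zero_freq, mul_zero])
      (summable_mul_hat (fun k => (norm_exp_omega _ _).le) u)) k

theorem norm_S_le (hs : 0 ≤ s) (t : ℝ) (u : Hs L s) : ‖S L s t u‖ ≤ ‖u‖ :=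
  Hs.norm_le_of_hat fun k => by rw [hat_S hs, norm_mul, norm_exp_omega, one_mul]

/-- The group `S(t)` is the exponential of `-tW`. -/
theorem flow_WCLM (hs : 0 ≤ s) (t : ℝ) (u : Hs L s) : flow (WCLM L hs) t u = S L s t u := by
  have : CompleteSpace (Hs L s) := Hs.completeSpace hs
  refine Hs.ext_hat fun k => ?_
  rw [hat_S hs]
  set z : ℂ := -(Complex.I * (t : ℂ) * (omega (k / L) : ℂ)) with hz
  have h1 : HasSum (fun n : ℕ => ((n.factorial : ℝ)⁻¹) • (t • -WCLM L hs) ^ n)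
      (flow (WCLM L hs) t) := NormedSpace.exp_series_hasSum_exp' (𝕂 := ℝ) (t • -WCLM L hs)
  -- Each Fourier coefficient is a bounded functional, so the operator exponential series can be
  -- compared with the scalar one frequency by frequency.
  have h2 := ((hatCLM L hs k).comp (ContinuousLinearMap.apply ℝ (Hs L s) u)).hasSum h1
  have h3 : HasSum (fun n : ℕ => ((n.factorial : ℂ)⁻¹) • z ^ n) (Complex.exp z) := by
    rw [Complex.exp_eq_exp_ℂ]
    exact NormedSpace.exp_series_hasSum_exp' (𝕂 := ℂ) z
  have h4 := h3.mul_right (hat L u k)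
  have hpow : ∀ n : ℕ, hat L (((t • -WCLM L hs) ^ n : Hs L s →L[ℝ] Hs L s) u : Hs L s) k =
      z ^ n * hat L u k := by
    intro n
    induction n with
    | zero => simp
    | succ n ih =>
      have h5 : ((t • -WCLM L hs) ^ (n + 1) : Hs L s →L[ℝ] Hs L s) u =
          (-t) • W L s (((t • -WCLM L hs) ^ n : Hs L s →L[ℝ] Hs L s) u) := by
        rw [pow_succ', smul_neg, neg_smul]
        rfl
      rw [h5, Hs.hat_real_smul, hat_W hs, ih, pow_succ', hz]
      push_cast
      ring
  have h5 : ∀ n : ℕ, ((hatCLM L hs k).comp (ContinuousLinearMap.apply ℝ (Hs L s) u))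
      (((n.factorial : ℝ)⁻¹) • (t • -WCLM L hs) ^ n) =
      ((n.factorial : ℂ)⁻¹) • z ^ n * hat L u k := fun n => by
    change hat L (((n.factorial : ℝ)⁻¹ • ((t • -WCLM L hs) ^ n : Hs L s →L[ℝ] Hs L s) u :
      Hs L s)) k = _
    rw [Hs.hat_real_smul, hpow, smul_eq_mul]
    push_cast
    ring
  rw [funext h5] at h2
  exact h2.unique h4

end Operators

/-! ### Bounded bilinear multipliers, uniformly in `L` -/

section Bilinear

variable {L : ℝ} [hL : Fact (0 < L)] {s : ℝ}

/-- The constant of normalisation in the Fourier coefficients of a product. -/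
noncomputable def convConst (L : ℝ) : ℝ := (Real.sqrt (2 * Real.pi * L))⁻¹

theorem convConst_sq (L : ℝ) [hL : Fact (0 < L)] : convConst L ^ 2 = (2 * Real.pi * L)⁻¹ := by
  rw [convConst, inv_pow, Real.sq_sqrt (torusLengthPos L).out.le]

/-- The `k`-th coefficient of the bilinear Fourier multiplier of symbol `m`. -/
noncomputable def bilinCoeff (L : ℝ) (m : ℤ → ℤ → ℂ) (f g : ℤ → ℂ) (k : ℤ) : ℂ :=
  (convConst L : ℂ) * ∑' j, m j (k - j) * (f j * g (k - j))

/-- The weight in the Schur test for bilinear multipliers. -/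
noncomputable def schurWeight (L σ : ℝ) (k : ℤ) : ℝ := bracket (k / L) ^ (-(4 * σ))

/-- The constant in the Schur test for bilinear multipliers, uniform in the length of the torus. -/
noncomputable def schurConst (σ : ℝ) : ℝ := 2 ^ (4 * σ) * (∑' k : ℤ, bracket k ^ (-(4 * σ))) * 2

theorem schurConst_nonneg (σ : ℝ) : 0 ≤ schurConst σ :=
  mul_nonneg (mul_nonneg (by positivity)
    (tsum_nonneg fun k => Real.rpow_nonneg (bracket_pos _).le _)) two_pos.le

/-- A symbol bound that makes a bilinear multiplier bounded from `H^s₁ × H^s₂` to `H^s₃`. -/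
def SymbolBound (L σ s₁ s₂ s₃ M : ℝ) (m : ℤ → ℤ → ℂ) : Prop :=
  ∀ j l : ℤ, j ≠ 0 → l ≠ 0 → ‖m j l‖ ^ 2 * bracket ((j + l : ℤ) / L) ^ (2 * s₃) ≤
    M * (schurWeight L σ j + schurWeight L σ l) *
      (bracket (j / L) ^ (2 * s₁) * bracket (l / L) ^ (2 * s₂))

/-- The Schur test, where the sum of the weights grows like `L` and is cancelled by the
normalisation `(2πL)⁻¹`. The alternative in `hf0` admits a first factor of nonzero mean when the
symbol kills it, as needed for products. -/
theorem bilinCoeff_bound {σ s₁ s₂ s₃ M : ℝ} (hL1 : 1 ≤ L) (hσ : 1 / 4 < σ) (hM : 0 ≤ M)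
    {m : ℤ → ℤ → ℂ} (hm : SymbolBound L σ s₁ s₂ s₃ M m) {f g : ℤ → ℂ}
    (hf0 : f 0 = 0 ∨ ∀ l, m 0 l = 0) (hg0 : g 0 = 0)
    (hf : Summable fun k : ℤ => bracket (k / L) ^ (2 * s₁) * ‖f k‖ ^ 2)
    (hg : Summable fun k : ℤ => bracket (k / L) ^ (2 * s₂) * ‖g k‖ ^ 2) :
    (∀ k, Summable fun j => m j (k - j) * (f j * g (k - j))) ∧
      (Summable fun k : ℤ => bracket (k / L) ^ (2 * s₃) * ‖bilinCoeff L m f g k‖ ^ 2) ∧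
      ∑' k : ℤ, bracket (k / L) ^ (2 * s₃) * ‖bilinCoeff L m f g k‖ ^ 2 ≤
        M * schurConst σ * ((∑' k : ℤ, bracket (k / L) ^ (2 * s₁) * ‖f k‖ ^ 2) *
          ∑' k : ℤ, bracket (k / L) ^ (2 * s₂) * ‖g k‖ ^ 2) := by
  have hp : ∀ (p : ℝ) (k : ℤ), 0 < bracket (k / L) ^ p := fun p k =>
    Real.rpow_pos_of_pos (bracket_pos _) _
  obtain ⟨hsφ, hφ⟩ := summable_bracket_div (p := 4 * σ) (by linarith) hL1
  obtain ⟨h1, h2, h3⟩ := kernel_bound (φ := schurWeight L σ)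
    (wx := fun k => bracket (k / L) ^ (2 * s₁))
    (wy := fun k => bracket (k / L) ^ (2 * s₂)) (wz := fun k => bracket (k / L) ^ (2 * s₃))
    (f := f) (g := g) (m := m) hM (fun k => (hp _ k).le) hsφ (fun k => (hp _ k).le)
    (fun k => (hp _ k).le) (hp _) hf hg (fun j l hj hl => by
      have hl0 : l ≠ 0 := fun h => hl (h ▸ hg0)
      by_cases hj0 : j = 0
      · have h4 : m j l = 0 := by
          rcases hf0 with h | h
          · exact absurd (hj0 ▸ h) hj
          · rw [hj0]; exact h l
        rw [h4, norm_zero]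
        have := hp (-(4 * σ)) j
        have := hp (-(4 * σ)) l
        have := hp (2 * s₁) j
        have := hp (2 * s₂) l
        simp only [schurWeight]
        rw [zero_pow two_ne_zero, zero_mul]
        positivity
      · exact hm j l hj0 hl0)
  have hsq : ∀ k : ℤ, bracket (k / L) ^ (2 * s₃) * ‖bilinCoeff L m f g k‖ ^ 2 =
      (2 * Real.pi * L)⁻¹ * (bracket (k / L) ^ (2 * s₃) *
        ‖∑' j, m j (k - j) * (f j * g (k - j))‖ ^ 2) := fun k => by
    rw [bilinCoeff, norm_mul, mul_pow, Complex.norm_real, Real.norm_eq_abs, sq_abs, convConst_sq]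
    ring
  refine ⟨h1, ?_, ?_⟩
  · simp only [hsq]
    exact h2.mul_left _
  · simp only [hsq]
    rw [tsum_mul_left]
    have hL0 := hL.out
    have hpi : 1 ≤ Real.pi := by linarith [Real.pi_gt_three]
    have hFG : 0 ≤ (∑' k : ℤ, bracket (k / L) ^ (2 * s₁) * ‖f k‖ ^ 2) *
        ∑' k : ℤ, bracket (k / L) ^ (2 * s₂) * ‖g k‖ ^ 2 :=
      mul_nonneg (tsum_nonneg fun k => mul_nonneg (hp _ k).le (sq_nonneg _))
        (tsum_nonneg fun k => mul_nonneg (hp _ k).le (sq_nonneg _))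
    have hφ' : ∑' k, schurWeight L σ k ≤ schurConst σ * L := by
      refine hφ.trans (le_of_eq ?_)
      rw [schurConst]
      ring
    have hc := schurConst_nonneg σ
    calc _ ≤ (2 * Real.pi * L)⁻¹ * (2 * M * (∑' k, schurWeight L σ k) * _) :=
          mul_le_mul_of_nonneg_left h3 (by positivity)
      _ ≤ (2 * 1 * L)⁻¹ * (2 * M * (schurConst σ * L) * _) := by
          have hS : 0 ≤ ∑' k, schurWeight L σ k := tsum_nonneg fun k => (hp _ k).le
          gcongr
      _ = _ := by field_simp

/-- Bounded bilinear multipliers on `H^s`. -/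
theorem exists_bilinear {σ M : ℝ} (hs : 0 ≤ s) (hL1 : 1 ≤ L) (hσ : 1 / 4 < σ) (hM : 0 ≤ M)
    {m : ℤ → ℤ → ℂ} (hm : SymbolBound L σ s s s M m) (hm0 : ∀ j, m j (-j) = 0) :
    ∃ B : Hs L s →L[ℝ] Hs L s →L[ℝ] Hs L s,
      (∀ u v : Hs L s, ∀ k, hat L (B u v) k = bilinCoeff L m (hat L u) (hat L v) k) ∧
      (∀ u v : Hs L s, ‖B u v‖ ≤ Real.sqrt (M * schurConst σ) * ‖u‖ * ‖v‖) := by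
  have hb := fun u v : Hs L s => bilinCoeff_bound hL1 hσ hM hm (Or.inl u.hat_zero_freq)
    v.hat_zero_freq u.summable v.summable
  have hex : ∀ u v : Hs L s, ∃ w : Hs L s, ∀ k, hat L w k =
      bilinCoeff L m (hat L u) (hat L v) k := fun u v =>
    exists_Hs hs _ (by simp [bilinCoeff, hm0]) (hb u v).2.1
  choose b hb' using hex
  have hnorm : ∀ u v : Hs L s, ‖b u v‖ ≤ Real.sqrt (M * schurConst σ) * ‖u‖ * ‖v‖ := fun u v => by
    have h1 := (hb u v).2.2
    rw [← Hs.norm_sq, ← Hs.norm_sq] at h1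
    refine abs_le_of_sq_le_sq' ?_ (by positivity) |>.2
    rw [Hs.norm_sq, mul_pow, mul_pow, Real.sq_sqrt (mul_nonneg hM (schurConst_nonneg σ)),
      mul_assoc (M * _)]
    simpa only [hb'] using h1
  let bl : Hs L s →ₗ[ℝ] Hs L s →ₗ[ℝ] Hs L s := LinearMap.mk₂ ℝ b
    (fun u u' v => Hs.ext_hat fun k => by
      rw [Hs.hat_add, hb', hb', hb', bilinCoeff, bilinCoeff, bilinCoeff, ← mul_add,
        ← ((hb u v).1 k).tsum_add ((hb u' v).1 k)]
      congr 1
      refine tsum_congr fun j => ?_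
      rw [Hs.hat_add]
      ring)
    (fun c u v => Hs.ext_hat fun k => by
      rw [Hs.hat_real_smul, hb', hb', bilinCoeff, bilinCoeff, mul_left_comm (c : ℂ),
        ← tsum_mul_left (a := (c : ℂ))]
      congr 1
      refine tsum_congr fun j => ?_
      rw [Hs.hat_real_smul]
      ring)
    (fun u v v' => Hs.ext_hat fun k => by
      rw [Hs.hat_add, hb', hb', hb', bilinCoeff, bilinCoeff, bilinCoeff, ← mul_add,
        ← ((hb u v).1 k).tsum_add ((hb u v').1 k)]
      congr 1
      refine tsum_congr fun j => ?_
      rw [Hs.hat_add]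
      ring)
    (fun c u v => Hs.ext_hat fun k => by
      rw [Hs.hat_real_smul, hb', hb', bilinCoeff, bilinCoeff, mul_left_comm (c : ℂ),
        ← tsum_mul_left (a := (c : ℂ))]
      congr 1
      refine tsum_congr fun j => ?_
      rw [Hs.hat_real_smul]
      ring)
  exact ⟨bl.mkContinuous₂ _ hnorm, hb', hnorm⟩

end Bilinear

theorem bilinCoeff_swap (L : ℝ) (m : ℤ → ℤ → ℂ) (f g : ℤ → ℂ) (k : ℤ) :
    bilinCoeff L m f g k = bilinCoeff L (fun j l => m l j) g f k := by
  rw [bilinCoeff, bilinCoeff, ← (Equiv.subLeft k).tsum_eq]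
  congr 1
  refine tsum_congr fun j => ?_
  simp only [Equiv.subLeft_apply, sub_sub_cancel]
  ring

/-! ### Fourier coefficients of products, sums and conjugates -/

section Fourier

open ComplexConjugate

variable {L : ℝ} [hL : Fact (0 < L)] {s : ℝ}

theorem hat_congr_ae {f g : Torus L → ℂ}
    (h : f =ᵐ[AddCircle.haarAddCircle (T := 2 * Real.pi * L)] g) (k : ℤ) :
    hat L f k = hat L g k := by
  rw [hat_eq, hat_eq, fourierCoeff_congr_ae h]

theorem hat_conj (f : Torus L → ℂ) (k : ℤ) :
    hat L (fun x => conj (f x)) k = conj (hat L f (-k)) := by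
  rw [hat_eq, hat_eq, map_mul, Complex.conj_ofReal]
  congr 1
  simp only [fourierCoeff]
  rw [← integral_conj]
  refine integral_congr_ae (Filter.Eventually.of_forall fun x => ?_)
  simp only [smul_eq_mul, map_mul, neg_neg, fourier_neg]

/-- Parseval's identity for the pair `e_k · conj f` and `g`, both in `L²`, whose inner product is
the `k`-th coefficient of `fg`. -/
theorem fourierCoeff_mul_hasSum (f g : L2 L) (k : ℤ) :
    HasSum (fun j => fourierCoeff f j * fourierCoeff g (k - j))
      (fourierCoeff (fun x => f x * g x) k) := by
  have hT : Fact (0 < 2 * Real.pi * L) := torusLengthPos L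
  have hmem : MemLp (fun x => fourier k x * conj (f x)) 2
      (AddCircle.haarAddCircle (T := 2 * Real.pi * L)) := by
    refine (Lp.memLp (star f)).congr_norm ?_ ?_
    · exact (fourier k).continuous.aestronglyMeasurable.mul
        (Complex.continuous_conj.comp_aestronglyMeasurable (Lp.aestronglyMeasurable f))
    · filter_upwards [Lp.coeFn_star f] with x hx
      rw [hx, norm_mul, fourier_apply, Circle.norm_coe, one_mul]
      simp
  set q : L2 L := hmem.toLp _ with hq
  have hqe := hmem.coeFn_toLp
  have h := (fourierBasis (T := 2 * Real.pi * L)).hasSum_inner_mul_inner q g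
  have hin : inner ℂ q g = fourierCoeff (fun x => f x * g x) k := by
    rw [L2.inner_def, fourierCoeff]
    refine integral_congr_ae ?_
    filter_upwards [hqe] with x hx
    rw [hq, hx, RCLike.inner_apply, map_mul, Complex.conj_conj, smul_eq_mul, fourier_neg]
    ring
  have hco : ∀ j, inner ℂ q (fourierBasis (T := 2 * Real.pi * L) j) = fourierCoeff f (k - j) := by
    intro j
    rw [coe_fourierBasis, L2.inner_def, fourierCoeff]
    refine integral_congr_ae ?_
    filter_upwards [hqe, coeFn_fourierLp (T := 2 * Real.pi * L) 2 j] with x hx hj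
    rw [hq, hx, hj, RCLike.inner_apply, map_mul, Complex.conj_conj, smul_eq_mul, neg_sub,
      sub_eq_add_neg, fourier_add, fourier_neg]
    ring
  rw [hin] at h
  have h2 : ∀ j, inner ℂ (fourierBasis (T := 2 * Real.pi * L) j) g = fourierCoeff g j := fun j => by
    rw [← fourierBasis.repr_apply_apply, fourierBasis_repr]
  simp only [hco, h2] at h
  rw [← (Equiv.subLeft k).hasSum_iff] at h
  simpa [Function.comp_def] using h

theorem hat_mul (f g : L2 L) (k : ℤ) :
    hat L (fun x => f x * g x) k = bilinCoeff L (fun _ _ => 1) (hat L f) (hat L g) k := by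
  have h0 : ((Real.sqrt (2 * Real.pi * L) : ℝ) : ℂ) ≠ 0 := by
    exact_mod_cast (Real.sqrt_pos.2 (torusLengthPos L).out).ne'
  rw [hat_eq, ← (fourierCoeff_mul_hasSum f g k).tsum_eq, bilinCoeff, convConst, ← tsum_mul_left,
    ← tsum_mul_left]
  refine tsum_congr fun j => ?_
  rw [hat_eq, hat_eq]
  push_cast
  field_simp

theorem integrable_mul (f g : L2 L) : Integrable (fun x => f x * g x)
    (AddCircle.haarAddCircle (T := 2 * Real.pi * L)) :=
  (Lp.memLp f).integrable_mul (Lp.memLp g)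

theorem hat_finsetSum {ι : Type*} (t : Finset ι) {f : ι → Torus L → ℂ}
    (hf : ∀ i ∈ t, Integrable (f i) (AddCircle.haarAddCircle (T := 2 * Real.pi * L))) (k : ℤ) :
    hat L (fun x => ∑ i ∈ t, f i x) k = ∑ i ∈ t, hat L (f i) k := by
  simp only [hat_eq, ← Finset.mul_sum]
  congr 1
  simp only [fourierCoeff, Finset.smul_sum]
  refine integral_finsetSum t fun i hi => ?_
  have hb := (hf i hi).bdd_mul (c := 1) (f := fun x => fourier (-k) x)
    (fourier (-k)).continuous.aestronglyMeasurable
    (Filter.Eventually.of_forall fun x => by rw [fourier_apply, Circle.norm_coe])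
  exact hb

/-- The Fourier coefficients of the complex conjugate. -/
theorem exists_conj (hs : 0 ≤ s) : ∃ J : Hs L s →L[ℝ] Hs L s,
    ∀ (u : Hs L s) (k : ℤ), hat L (J u) k = conj (hat L u (-k)) := by
  have hw : ∀ (u : Hs L s) (k : ℤ), bracket (k / L) ^ (2 * s) * ‖conj (hat L u (-k))‖ ^ 2 =
      bracket (((Equiv.neg ℤ) k : ℤ) / L) ^ (2 * s) * ‖hat L u ((Equiv.neg ℤ) k)‖ ^ 2 := by
    intro u k
    rw [Equiv.neg_apply, RCLike.norm_conj, bracket, bracket]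
    push_cast
    rw [neg_div, neg_sq]
  have hex : ∀ u : Hs L s, ∃ v : Hs L s, ∀ k, hat L v k = conj (hat L u (-k)) := fun u => by
    refine exists_Hs hs _ (by rw [neg_zero, u.hat_zero_freq, map_zero]) ?_
    rw [funext (hw u)]
    exact (Equiv.neg ℤ).summable_iff.2 u.summable
  choose J hJ using hex
  refine ⟨LinearMap.mkContinuous
    { toFun := J
      map_add' := fun u v => Hs.ext_hat fun k => by
        rw [Hs.hat_add, hJ, hJ, hJ, Hs.hat_add, map_add]
      map_smul' := fun c u => Hs.ext_hat fun k => by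
        rw [RingHom.id_apply, Hs.hat_real_smul, hJ, hJ, Hs.hat_real_smul, map_mul,
          Complex.conj_ofReal] } 1 fun u => ?_, hJ⟩
  rw [one_mul]
  change ‖J u‖ ≤ ‖u‖
  rw [Hs.norm_def, Hs.norm_def]
  simp only [hJ]
  rw [funext (hw u), (Equiv.neg ℤ).tsum_eq
    (fun k : ℤ => bracket (k / L) ^ (2 * s) * ‖hat L u k‖ ^ 2)]

theorem im_eq_zero_iff (u : Hs L s) :
    (∀ᵐ x ∂(AddCircle.haarAddCircle (T := 2 * Real.pi * L)), (u x).im = 0) ↔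
      ∀ k, hat L u k = conj (hat L u (-k)) := by
  constructor
  · intro h k
    rw [← hat_conj]
    refine hat_congr_ae ?_ k
    filter_upwards [h] with x hx
    exact (Complex.conj_eq_iff_im.2 hx).symm
  · intro h
    have hst : star u.toL2 = u.toL2 := by
      rw [← sub_eq_zero]
      refine eq_zero_of_hat _ fun k => ?_
      rw [sub_eq_add_neg, ← neg_one_smul ℂ, BBM.hat_add, BBM.hat_smul, h k, ← hat_conj]
      rw [hat_congr_ae (Lp.coeFn_star u.toL2) k]
      have h1 : (star (u.toL2 : Torus L → ℂ)) = fun x => conj (u.toL2 x) := rfl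
      rw [h1]
      ring
    have h2 := Lp.coeFn_star u.toL2
    rw [hst] at h2
    filter_upwards [h2] with x hx
    exact Complex.conj_eq_iff_im.1 hx.symm

end Fourier

/-! ### Symbol bounds for the operators in use -/

section Symbols

variable {L σ s M : ℝ}

theorem bracket_rpow_pos (x p : ℝ) : 0 < bracket x ^ p := Real.rpow_pos_of_pos (bracket_pos x) p

theorem add_div_coe (L : ℝ) (j l : ℤ) : ((j + l : ℤ) : ℝ) / L = j / L + l / L := by
  push_cast
  rw [add_div]

theorem one_le_mul_abs_div {L : ℝ} (hL : 1 ≤ L) {k : ℤ} (hk : k ≠ 0) :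
    1 ≤ L * |(k : ℝ) / L| := by
  have hL0 : 0 < L := zero_lt_one.trans_le hL
  rw [abs_div, abs_of_pos hL0, mul_div_cancel₀ _ hL0.ne']
  exact_mod_cast Int.one_le_abs hk

theorem bracket_rpow_split (hr : 0 ≤ s - σ) (x y : ℝ) :
    bracket (x + y) ^ (2 * s) ≤ bracket (x + y) ^ (2 * σ) * (2 ^ (2 * (s - σ)) *
      (bracket x ^ (2 * (s - σ)) * bracket y ^ (2 * (s - σ)))) := by
  have h1 : bracket (x + y) ^ (2 * s) =
      bracket (x + y) ^ (2 * σ) * bracket (x + y) ^ (2 * (s - σ)) := by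
    rw [← Real.rpow_add (bracket_pos _)]
    ring_nf
  rw [h1]
  exact mul_le_mul_of_nonneg_left (bracket_add_rpow_le hr x y) (bracket_rpow_pos _ _).le

theorem bracket_rpow_mul_split (x s σ : ℝ) :
    bracket x ^ (2 * σ) * bracket x ^ (2 * (s - σ)) = bracket x ^ (2 * s) := by
  rw [← Real.rpow_add (bracket_pos _)]
  ring_nf

/-- A symbol bound at a low regularity `σ` gives one at every regularity `s ≥ σ`. -/
theorem SymbolBound.of_le (hr : 0 ≤ s - σ) {m : ℤ → ℤ → ℂ} (hm : SymbolBound L σ σ σ σ M m) :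
    SymbolBound L σ s s s (2 ^ (2 * (s - σ)) * M) m := by
  intro j l hj hl
  have h := hm j l hj hl
  rw [add_div_coe] at h ⊢
  have px := bracket_rpow_pos (j / L) (2 * (s - σ))
  have py := bracket_rpow_pos (l / L) (2 * (s - σ))
  calc _ ≤ ‖m j l‖ ^ 2 * (bracket (j / L + l / L) ^ (2 * σ) * (2 ^ (2 * (s - σ)) *
        (bracket (j / L) ^ (2 * (s - σ)) * bracket (l / L) ^ (2 * (s - σ))))) :=
        mul_le_mul_of_nonneg_left (bracket_rpow_split hr _ _) (sq_nonneg _)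
    _ = (‖m j l‖ ^ 2 * bracket (j / L + l / L) ^ (2 * σ)) * (2 ^ (2 * (s - σ)) *
        (bracket (j / L) ^ (2 * (s - σ)) * bracket (l / L) ^ (2 * (s - σ)))) := by ring
    _ ≤ _ := mul_le_mul_of_nonneg_right h (by positivity)
    _ = _ := by
      rw [← bracket_rpow_mul_split (j / L) s σ, ← bracket_rpow_mul_split (l / L) s σ]
      ring

/-- The symbol of `(u, v) ↦ W(uv)`. -/
noncomputable def nonlinSymbol (L : ℝ) (j l : ℤ) : ℂ := Complex.I * (omega ((j + l : ℤ) / L) : ℂ)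

/-- The symbol of the normal form, as a function of integers. -/
noncomputable def nfIntSymbol (L lam : ℝ) (j l : ℤ) : ℂ := nfSymbol lam (j / L) (l / L)

theorem nonlinSymbol_neg (L : ℝ) (j : ℤ) : nonlinSymbol L j (-j) = 0 := by
  simp [nonlinSymbol, omega]

theorem nfIntSymbol_neg (L lam : ℝ) (j : ℤ) : nfIntSymbol L lam j (-j) = 0 := by
  simp [nfIntSymbol, nfSymbol, omega, neg_div]

/-- The derivative gained by `ω` covers the output weight, since `σ ≤ 1`, and the Schur weights pay
for the constant. -/
theorem symbolBound_nonlin (hσ : σ ≤ 1 / 2) : SymbolBound L σ σ σ σ 1 (nonlinSymbol L) := by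
  intro j l _ _
  have h1 := two_le_sum_bracket_mul (j / L) (l / L) σ
  set x : ℝ := ((j + l : ℤ) : ℝ) / L
  have h2 : ‖nonlinSymbol L j l‖ = |omega x| := by
    rw [nonlinSymbol, norm_mul, Complex.norm_I, one_mul, Complex.norm_real, Real.norm_eq_abs]
  have h3 : bracket x ^ (2 * σ) ≤ bracket x ^ 2 := by
    rw [← Real.rpow_natCast]
    exact Real.rpow_le_rpow_of_exponent_le (one_le_bracket _) (by push_cast; linarith)
  have h4 := pow_le_one₀ (n := 2) (mul_nonneg (abs_nonneg _) (bracket_pos _).le)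
    (abs_omega_mul_bracket_le x)
  rw [h2]
  calc |omega x| ^ 2 * bracket x ^ (2 * σ) ≤ |omega x| ^ 2 * bracket x ^ 2 := by gcongr
    _ = (|omega x| * bracket x) ^ 2 := by ring
    _ ≤ 2 := by linarith
    _ ≤ _ := by rw [one_mul]; exact h1

theorem symbolBound_nf {lam : ℝ} (hl : 0 < lam) (hL : 1 ≤ L) (hσ0 : 0 ≤ σ) (hσ : σ ≤ 1 / 2) :
    SymbolBound L σ σ σ σ (16 * L ^ 4 + lam⁻¹) (nfIntSymbol L lam) := by
  intro j l hj hl0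
  rw [add_div_coe]
  exact norm_sq_nfSymbol_le hl hL hσ0 hσ (one_le_mul_abs_div hL hj) (one_le_mul_abs_div hL hl0)

/-- The plain product loses `σ` derivatives; for `s = σ` it maps into `L²`, a form of the embedding
of `H^σ` in `L⁴`. -/
theorem symbolBound_one (hr : 0 ≤ s - σ) :
    SymbolBound L σ s s (s - σ) (2 ^ (2 * (s - σ))) fun _ _ => 1 := by
  intro j l _ _
  have h1 := two_le_sum_bracket_mul (j / L) (l / L) σ
  have px := bracket_rpow_pos (j / L) (2 * (s - σ))
  have py := bracket_rpow_pos (l / L) (2 * (s - σ))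
  rw [norm_one, one_pow, one_mul, add_div_coe]
  calc _ ≤ 2 ^ (2 * (s - σ)) *
        (bracket (j / L) ^ (2 * (s - σ)) * bracket (l / L) ^ (2 * (s - σ))) * 1 := by
        rw [mul_one]
        exact bracket_add_rpow_le hr _ _
    _ ≤ 2 ^ (2 * (s - σ)) *
        (bracket (j / L) ^ (2 * (s - σ)) * bracket (l / L) ^ (2 * (s - σ))) * _ :=
        mul_le_mul_of_nonneg_left (one_le_two.trans h1) (by positivity)
    _ = _ := by
      rw [← bracket_rpow_mul_split (j / L) s σ, ← bracket_rpow_mul_split (l / L) s σ, schurWeight,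
        schurWeight]
      ring

/-- Recovers the `σ` derivatives lost by the plain product: the inner `ω` is attached to the outer
symbol, so that the product itself is the first argument. -/
theorem symbolBound_cubic {lam : ℝ} (hl : 0 < lam) (hL : 1 ≤ L) (hσ0 : 0 ≤ σ) (hσ : σ ≤ 1 / 2)
    (hr : 0 ≤ s - σ) : SymbolBound L σ (s - σ) s s (2 ^ (2 * (s - σ)) * (36 * L ^ 2))
      fun j l => nfIntSymbol L lam j l * (Complex.I * (omega (j / L) : ℂ)) := by
  intro j l hj hl0
  have hL0 : L ≠ 0 := (zero_lt_one.trans_le hL).ne'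
  have hj0 : (j : ℝ) / L ≠ 0 := div_ne_zero (by exact_mod_cast hj) hL0
  have h := norm_sq_nfSymbol_mul_omega_le hl hL hσ0 hσ hj0 (one_le_mul_abs_div hL hl0)
  rw [add_div_coe]
  have px := bracket_rpow_pos (j / L) (2 * (s - σ))
  have py := bracket_rpow_pos (l / L) (2 * (s - σ))
  have pw := bracket_rpow_pos (j / L) (-(4 * σ))
  have pz := bracket_rpow_pos (l / L) (2 * σ)
  have pw' := bracket_rpow_pos (l / L) (-(4 * σ))
  set m : ℂ := nfIntSymbol L lam j l * (Complex.I * (omega (j / L) : ℂ))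
  calc _ ≤ ‖m‖ ^ 2 * (bracket (j / L + l / L) ^ (2 * σ) * (2 ^ (2 * (s - σ)) *
        (bracket (j / L) ^ (2 * (s - σ)) * bracket (l / L) ^ (2 * (s - σ))))) :=
        mul_le_mul_of_nonneg_left (bracket_rpow_split hr _ _) (sq_nonneg _)
    _ = (‖m‖ ^ 2 * bracket (j / L + l / L) ^ (2 * σ)) * (2 ^ (2 * (s - σ)) *
        (bracket (j / L) ^ (2 * (s - σ)) * bracket (l / L) ^ (2 * (s - σ)))) := by ring
    _ ≤ (36 * L ^ 2 * bracket (l / L) ^ (-(4 * σ)) * bracket (l / L) ^ (2 * σ)) *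
        (2 ^ (2 * (s - σ)) *
        (bracket (j / L) ^ (2 * (s - σ)) * bracket (l / L) ^ (2 * (s - σ)))) :=
        mul_le_mul_of_nonneg_right h (by positivity)
    _ ≤ (36 * L ^ 2 * (bracket (j / L) ^ (-(4 * σ)) + bracket (l / L) ^ (-(4 * σ))) *
        bracket (l / L) ^ (2 * σ)) * (2 ^ (2 * (s - σ)) *
        (bracket (j / L) ^ (2 * (s - σ)) * bracket (l / L) ^ (2 * (s - σ)))) := by
        gcongr
        linarith
    _ = _ := by
      rw [← bracket_rpow_mul_split (l / L) s σ, schurWeight, schurWeight]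
      ring

end Symbols

/-! ### The normal form of the equation on `H^s` -/

section NormalForm

variable {L : ℝ} [hL : Fact (0 < L)] {s σ : ℝ}

/-- The bilinear operator on `H^s` has the Fourier symbol `m`. -/
def HasSymbol (B : Hs L s →L[ℝ] Hs L s →L[ℝ] Hs L s) (m : ℤ → ℤ → ℂ) : Prop :=
  ∀ u v : Hs L s, ∀ k, hat L (B u v) k = bilinCoeff L m (hat L u) (hat L v) k

theorem bilinCoeff_nonlin (L : ℝ) (f g : ℤ → ℂ) (k : ℤ) : bilinCoeff L (nonlinSymbol L) f g k =
    Complex.I * (omega (k / L) : ℂ) * bilinCoeff L (fun _ _ => 1) f g k := by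
  rw [bilinCoeff, bilinCoeff, mul_left_comm, ← tsum_mul_left (a := Complex.I * _)]
  simp only [nonlinSymbol, add_sub_cancel, one_mul]

theorem HasSymbol.eq_W {N : Hs L s →L[ℝ] Hs L s →L[ℝ] Hs L s} (hN : HasSymbol N (nonlinSymbol L))
    (u v : Hs L s) : W L s (fun x => u x * v x) = N u v :=
  multiplier_eq fun k => by rw [hN, bilinCoeff_nonlin, hat_mul]

theorem HasSymbol.eq_W_sum {N : Hs L s →L[ℝ] Hs L s →L[ℝ] Hs L s}
    (hN : HasSymbol N (nonlinSymbol L)) {ι : Type*} (t : Finset ι) (u v : ι → Hs L s) :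
    W L s (fun x => ∑ i ∈ t, u i x * v i x) = ∑ i ∈ t, N (u i) (v i) :=
  multiplier_eq fun k => by
    have h1 : hat L (∑ i ∈ t, N (u i) (v i) : Hs L s) k = ∑ i ∈ t, hat L (N (u i) (v i)) k :=
      map_sum (AddMonoidHom.mk' (fun w : Hs L s => hat L w k) fun a b => Hs.hat_add a b k) _ t
    rw [h1, hat_finsetSum t (fun i _ => integrable_mul (u i).toL2 (v i).toL2), Finset.mul_sum]
    refine Finset.sum_congr rfl fun i _ => ?_
    rw [hN, bilinCoeff_nonlin, hat_mul]

theorem HasSymbol.comm {B : Hs L s →L[ℝ] Hs L s →L[ℝ] Hs L s} {m : ℤ → ℤ → ℂ}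
    (hB : HasSymbol B m) (hm : ∀ j l, m j l = m l j) (u v : Hs L s) : B u v = B v u :=
  Hs.ext_hat fun k => by
    rw [hB, hB, bilinCoeff_swap]
    simp only [← hm]

/-- The algebraic identity that defines the normal form. -/
theorem HasSymbol.normalForm_eq {lam M : ℝ} (hs : 0 ≤ s) (hL1 : 1 ≤ L) (hσ : 1 / 4 < σ)
    (hlam : 0 < lam) (hM : 0 ≤ M) (hm : SymbolBound L σ s s s M (nfIntSymbol L lam))
    {N B : Hs L s →L[ℝ] Hs L s →L[ℝ] Hs L s} (hN : HasSymbol N (nonlinSymbol L))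
    (hB : HasSymbol B (nfIntSymbol L lam)) (p q : Hs L s) :
    N p q = lam • B p q + WCLM L hs (B p q) - B (WCLM L hs p) q - B p (WCLM L hs q) := by
  have hsum : ∀ (u v : Hs L s) k,
      Summable fun j => nfIntSymbol L lam j (k - j) * (hat L u j * hat L v (k - j)) := fun u v =>
    (bilinCoeff_bound hL1 hσ hM hm (Or.inl u.hat_zero_freq) v.hat_zero_freq u.summable
      v.summable).1
  refine Hs.ext_hat fun k => ?_
  rw [Hs.hat_sub, Hs.hat_sub, Hs.hat_add, Hs.hat_real_smul, WCLM_apply hs (B p q), hat_W hs, hN,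
    hB, hB, hB]
  have h1 := (hsum p q k).hasSum.mul_left
    ((convConst L : ℂ) * ((lam : ℂ) + Complex.I * (omega (k / L) : ℂ)))
  have h2 := (hsum (WCLM L hs p) q k).hasSum.mul_left (convConst L : ℂ)
  have h3 := (hsum p (WCLM L hs q) k).hasSum.mul_left (convConst L : ℂ)
  have h4 := ((h1.sub h2).sub h3).tsum_eq
  simp only [bilinCoeff]
  refine Eq.trans ?_ (h4.trans (by ring))
  rw [← tsum_mul_left]
  refine tsum_congr fun j => ?_
  rw [WCLM_apply, WCLM_apply, hat_W hs, hat_W hs, nonlinSymbol, nfIntSymbol, nfSymbol, resonance]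
  have hxy : (j : ℝ) / L + ((k - j : ℤ) : ℝ) / L = k / L := by
    rw [← add_div_coe, add_sub_cancel]
  rw [hxy, add_sub_cancel]
  -- The denominator has real part `lam > 0`, so it is nonzero even where the resonance function
  -- vanishes.
  have hden : Complex.I * ((omega (k / L) - omega (j / L) - omega ((k - j : ℤ) / L) : ℝ) : ℂ) +
      (lam : ℂ) ≠ 0 := by
    intro h
    have := congrArg Complex.re h
    simp at this
    exact hlam.ne' this
  rw [div_mul_eq_mul_div, div_mul_eq_mul_div, div_mul_eq_mul_div]
  field_simp
  push_cast
  ring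

/-- Bound the plain product in `H^{s-σ}`, then the outer multiplier that includes the inner `ω`. The
squared constants multiply to `(6LA')²` with `A' = 2^{2(s-σ)} · schurConst σ`. -/
theorem HasSymbol.norm_cubic_le {lam : ℝ} (hL1 : 1 ≤ L) (hσ : 1 / 4 < σ)
    (hσ2 : σ ≤ 1 / 2) (hσs : σ ≤ s) (hlam : 0 < lam)
    {N B : Hs L s →L[ℝ] Hs L s →L[ℝ] Hs L s} (hN : HasSymbol N (nonlinSymbol L))
    (hB : HasSymbol B (nfIntSymbol L lam)) (p q r : Hs L s) :
    ‖B (N p q) r‖ ≤ 6 * L * (2 ^ (2 * (s - σ)) * schurConst σ) * ‖p‖ * ‖q‖ * ‖r‖ := by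
  have hr : 0 ≤ s - σ := sub_nonneg.2 hσs
  set A : ℝ := 2 ^ (2 * (s - σ)) with hA
  have hA0 : 0 < A := Real.rpow_pos_of_pos two_pos _
  have hc := schurConst_nonneg σ
  obtain ⟨-, hP, hP'⟩ := bilinCoeff_bound hL1 hσ hA0.le (symbolBound_one (L := L) hr)
    (Or.inl p.hat_zero_freq) q.hat_zero_freq p.summable q.summable
  -- The product of `p` and `q` need not have mean zero; `ω(0) = 0` removes its zero mode.
  obtain ⟨-, -, hC⟩ := bilinCoeff_bound hL1 hσ (by positivity)
    (symbolBound_cubic hlam hL1 (by linarith) hσ2 hr)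
    (Or.inr fun l => by simp [omega]) r.hat_zero_freq hP r.summable
  have heq : ∀ k, hat L (B (N p q) r) k = bilinCoeff L
      (fun j l => nfIntSymbol L lam j l * (Complex.I * (omega (j / L) : ℂ)))
      (bilinCoeff L (fun _ _ => 1) (hat L p) (hat L q)) (hat L r) k := fun k => by
    rw [hB, bilinCoeff, bilinCoeff]
    congr 1
    refine tsum_congr fun j => ?_
    rw [hN, bilinCoeff_nonlin]
    ring
  simp only [← heq] at hC
  rw [← Hs.norm_sq, ← Hs.norm_sq] at hC
  rw [← Hs.norm_sq, ← Hs.norm_sq] at hP'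
  have hL0 := hL.out
  refine abs_le_of_sq_le_sq' ?_ (by positivity) |>.2
  refine hC.trans ?_
  calc _ ≤ A * (36 * L ^ 2) * schurConst σ * ((A * schurConst σ * (‖p‖ ^ 2 * ‖q‖ ^ 2)) *
        ‖r‖ ^ 2) := by gcongr
    _ = _ := by ring

/-- The normal form of the equation, with its constants. -/
theorem exists_normalForm (hL1 : 1 ≤ L) (hσ : 1 / 4 < σ) (hσ2 : σ ≤ 1 / 2) (hσs : σ ≤ s)
    (hs : 0 ≤ s) {T : ℝ} (hT : 0 < T) : ∃ N B : Hs L s →L[ℝ] Hs L s →L[ℝ] Hs L s,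
      HasSymbol N (nonlinSymbol L) ∧ NormalForm (WCLM L hs) N B T T⁻¹
        (Real.sqrt (2 ^ (2 * (s - σ)) * (16 * L ^ 4 + T) * schurConst σ))
        (6 * L * (2 ^ (2 * (s - σ)) * schurConst σ)) := by
  have hr : 0 ≤ s - σ := sub_nonneg.2 hσs
  have hL0 := hL.out
  have hc := schurConst_nonneg σ
  have hTi : 0 < T⁻¹ := inv_pos.2 hT
  obtain ⟨N, hN, -⟩ := exists_bilinear hs hL1 hσ (by positivity)
    (symbolBound_nonlin (L := L) hσ2 |>.of_le hr) (nonlinSymbol_neg L)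
  have hm := (symbolBound_nf hTi hL1 (by linarith) hσ2).of_le hr
  rw [inv_inv] at hm
  obtain ⟨B, hB, hBn⟩ := exists_bilinear hs hL1 hσ (by positivity) hm (nfIntSymbol_neg L T⁻¹)
  have hB' : HasSymbol B (nfIntSymbol L T⁻¹) := hB
  have hN' : HasSymbol N (nonlinSymbol L) := hN
  refine ⟨N, B, hN, ?_⟩
  have hcub := HasSymbol.norm_cubic_le hL1 hσ hσ2 hσs hTi hN' hB'
  exact
    { T_pos := hT
      lam_nonneg := hTi.le
      lam_mul_le := (inv_mul_cancel₀ hT.ne').le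
      b_nonneg := Real.sqrt_nonneg _
      κ_nonneg := by positivity
      norm_flow_le := fun t x => by rw [flow_WCLM hs]; exact norm_S_le hs t x
      eq := HasSymbol.normalForm_eq hs hL1 hσ hTi (by positivity) hm hN' hB'
      norm_le := hBn
      norm_le_left := hcub
      norm_le_right := fun p q r => by
        rw [hB'.comm (fun j l => nfSymbol_comm _ _ _)]
        exact hcub p q r }

/-- The symbol is `i` times a real odd function of the output frequency, so conjugating it and
reflecting the frequencies leaves it unchanged. -/
theorem HasSymbol.conj_eq {N : Hs L s →L[ℝ] Hs L s →L[ℝ] Hs L s}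
    (hN : HasSymbol N (nonlinSymbol L)) {J : Hs L s →L[ℝ] Hs L s}
    (hJ : ∀ (u : Hs L s) (k : ℤ), hat L (J u) k = starRingEnd ℂ (hat L u (-k))) (u v : Hs L s) :
    J (N u v) = N (J u) (J v) :=
  Hs.ext_hat fun k => by
    rw [hJ, hN, hN, bilinCoeff, bilinCoeff, map_mul, Complex.conj_ofReal, Complex.conj_tsum,
      ← (Equiv.neg ℤ).tsum_eq]
    congr 1
    refine tsum_congr fun j => ?_
    simp only [Equiv.neg_apply, map_mul, hJ, nonlinSymbol, Complex.conj_I, Complex.conj_ofReal]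
    rw [show -k - -j = -(k - j) by ring, show -j + -(k - j) = -k by ring, add_sub_cancel]
    simp only [omega]
    push_cast
    ring

theorem conj_WCLM (hs : 0 ≤ s) {J : Hs L s →L[ℝ] Hs L s}
    (hJ : ∀ (u : Hs L s) (k : ℤ), hat L (J u) k = starRingEnd ℂ (hat L u (-k))) (u : Hs L s) :
    J (WCLM L hs u) = WCLM L hs (J u) :=
  Hs.ext_hat fun k => by
    rw [hJ, WCLM_apply, WCLM_apply, hat_W hs, hat_W hs, hJ]
    simp only [map_mul, Complex.conj_I, Complex.conj_ofReal, omega]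
    push_cast
    ring

theorem HasSymbol.isDyson {N : Hs L s →L[ℝ] Hs L s →L[ℝ] Hs L s}
    (hN : HasSymbol N (nonlinSymbol L)) (hs : 0 ≤ s) (ε : ℝ) (a : Hs L s) :
    IsDyson (WCLM L hs) N ε a (dysonTerm L s ε a) where
  zero t := by rw [dysonTerm_zero, flow_WCLM]
  succ n t := by
    rw [dysonTerm_succ]
    simp only [flow_WCLM, hN.eq_W_sum]
    rfl

theorem HasSymbol.isSolution_iff {N : Hs L s →L[ℝ] Hs L s →L[ℝ] Hs L s}
    (hN : HasSymbol N (nonlinSymbol L)) (hs : 0 ≤ s) (ε T : ℝ) (a : Hs L s) (u : ℝ → Hs L s) :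
    IsSolution L s ε T a u ↔ SolvesOn (WCLM L hs) N ε T a u := by
  have h : ∀ t, -(W L s (u t) + (ε : ℂ) • W L s fun x => u t x ^ 2) =
      -(WCLM L hs (u t) + ε • N (u t) (u t)) := fun t => by
    rw [← hN.eq_W]
    simp only [sq]
    rfl
  simp only [IsSolution, SolvesOn, h]

end NormalForm

/-! ### The choice of the constant -/

section SmallData

theorem sqrt_constant_le {A L T : ℝ} (hA : 0 ≤ A) (hT : 0 ≤ T) :
    Real.sqrt (A * (16 * L ^ 4 + T)) ≤ (A + 1) * (4 * L ^ 2 + Real.sqrt T) := by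
  have hT' := Real.sqrt_nonneg T
  refine Real.sqrt_le_iff.2 ⟨by positivity, ?_⟩
  have h1 : 16 * L ^ 4 + T ≤ (4 * L ^ 2 + Real.sqrt T) ^ 2 := by
    have := Real.sq_sqrt hT
    nlinarith [mul_nonneg (sq_nonneg L) hT']
  have h2 : A ≤ (A + 1) ^ 2 := by nlinarith
  rw [mul_pow]
  exact mul_le_mul h2 h1 (by positivity) (by positivity)

/-- The choice of the constant `C = (1392 (A + 1))²`. -/
theorem small_of_constant {A C L D ε T : ℝ} (hA : 0 ≤ A) (hC : C = (1392 * (A + 1)) ^ 2)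
    (hL : 1 ≤ L) (hD : 1 ≤ D) (hε : 0 < ε) (hεC : ε ≤ 1 / (C * D ^ 2 * L ^ 5))
    (hT : T = (ε ^ 2)⁻¹ * (1 / (C * D ^ 2 * L ^ 2))) :
    NormalForm.Small T (Real.sqrt (A * (16 * L ^ 4 + T))) (6 * L * A) ε (D * Real.sqrt L) := by
  set K := A + 1 with hK
  have hK1 : 1 ≤ K := by linarith
  set Q := 1392 * K with hQ
  have hQ1 : 1392 ≤ Q := by linarith
  have hQ0 : 0 < Q := by linarith
  have hC0 : 0 < C := by rw [hC]; positivity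
  have hD0 : 0 < D := by linarith
  have hL0 : 0 < L := by linarith
  set l := Real.sqrt L with hl
  have hl1 : 1 ≤ l := Real.one_le_sqrt.2 hL
  have hll : l ^ 2 = L := Real.sq_sqrt hL0.le
  have hl0 : 0 < l := by linarith
  -- The time is chosen so that its root is `1 / (εQDL)`: the factor `√T` in the bound on `B` is
  -- compensated by `ε`.
  have hsT : Real.sqrt T = 1 / (ε * Q * D * L) := by
    rw [Real.sqrt_eq_iff_mul_self_eq (by rw [hT]; positivity) (by positivity), hT, hC]
    field_simp
  refine ⟨by positivity, hε.le, ?_⟩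
  have h1 : ε * L ^ 2 * (D * l) ≤ 1 / Q := by
    have h2 : ε * (C * D ^ 2 * L ^ 5) ≤ 1 := by
      rwa [le_div_iff₀ (by positivity)] at hεC
    rw [le_div_iff₀ hQ0]
    refine le_trans ?_ h2
    have h3 : l ≤ L := by rw [← hll]; nlinarith
    have h4 : L ^ 2 * L ≤ L ^ 5 := by
      rw [← pow_succ]
      exact pow_le_pow_right₀ hL (by norm_num)
    have h5 : D ≤ D ^ 2 := by nlinarith
    have h6 : Q ≤ C := by rw [hC]; nlinarith
    calc ε * L ^ 2 * (D * l) * Q = ε * (Q * D * (L ^ 2 * l)) := by ring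
      _ ≤ ε * (C * D ^ 2 * (L ^ 2 * L)) := by gcongr
      _ ≤ ε * (C * D ^ 2 * L ^ 5) := by
        gcongr
  have h7 : ε * Real.sqrt T * (D * l) ≤ 1 / Q := by
    have h8 : ε * Real.sqrt T * (D * l) = 1 / Q * (l / L) := by
      rw [hsT]
      field_simp
    rw [h8]
    refine mul_le_of_le_one_right (by positivity) ((div_le_one hL0).2 ?_)
    rw [← hll]
    nlinarith
  have h9 : ε ^ 2 * T * (6 * L * A) * (D * l) ^ 2 = 6 * A / Q ^ 2 := by
    rw [mul_pow, hll, hT, hC]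
    field_simp
  have h10 : ε * Real.sqrt (A * (16 * L ^ 4 + T)) * (D * l) ≤ K * (5 * (1 / Q)) := by
    have h11 := sqrt_constant_le (L := L) (T := T) hA (by rw [hT]; positivity)
    calc _ ≤ ε * (K * (4 * L ^ 2 + Real.sqrt T)) * (D * l) := by gcongr
      _ = K * (4 * (ε * L ^ 2 * (D * l)) + ε * Real.sqrt T * (D * l)) := by ring
      _ ≤ K * (5 * (1 / Q)) := by gcongr; linarith
  have h12 : 6 * A / Q ^ 2 ≤ 6 * (K * (1 / Q)) := by
    rw [div_le_iff₀ (by positivity)]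
    have : 6 * (K * (1 / Q)) * Q ^ 2 = 6 * K * Q := by field_simp
    rw [this]
    nlinarith
  have h13 : K * (1 / Q) = 1 / 1392 := by
    rw [hQ]
    field_simp
  rw [h9]
  -- The two contributions are at most `24 · 5 / 1392` and `96 · 6 / 1392`, whose sum is exactly
  -- `1/2`.
  linarith

end SmallData

end BBM

/-! ### The main theorem -/

theorem mainTheorem4 (s : ℝ) (hs : 1 / 4 < s) :
    ∃ C : ℝ, 0 < C ∧ ∀ (L : ℝ) [Fact (0 < L)] (D ε T : ℝ), 1 ≤ L → 1 ≤ D →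
      0 < ε → ε ≤ 1 / (C * D ^ 2 * L ^ 5) →
      T = (ε ^ 2)⁻¹ * (1 / (C * D ^ 2 * L ^ 2)) →
      ∃ Ψ : ℝ → BBM.Hs L s → BBM.Hs L s,
        -- existence
        (∀ a : BBM.Hs L s, ‖a‖ ≤ D * Real.sqrt L →
          BBM.IsSolution L s ε T a (fun t => Ψ t a)) ∧
        -- uniqueness
        (∀ a : BBM.Hs L s, ‖a‖ ≤ D * Real.sqrt L →
          ∀ u : ℝ → BBM.Hs L s, BBM.IsSolution L s ε T a u →
            ∀ t ∈ Set.Icc (-T) T, u t = Ψ t a) ∧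
        -- (Lipschitz) continuous dependence on the initial datum
        (∀ a b : BBM.Hs L s, ‖a‖ ≤ D * Real.sqrt L → ‖b‖ ≤ D * Real.sqrt L →
          ∀ t ∈ Set.Icc (-T) T, ‖Ψ t a - Ψ t b‖ ≤ 2 * ‖a - b‖) ∧
        -- real-valued data have real-valued solutions
        (∀ a : BBM.Hs L s, ‖a‖ ≤ D * Real.sqrt L →
          (∀ᵐ x ∂(AddCircle.haarAddCircle (T := 2 * Real.pi * L)), (a x).im = 0) →
          ∀ t ∈ Set.Icc (-T) T,
            ∀ᵐ x ∂(AddCircle.haarAddCircle (T := 2 * Real.pi * L)), (Ψ t a x).im = 0) ∧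
        -- the flow is the sum of the Dyson series, with the bound on its terms
        (∀ a : BBM.Hs L s, ‖a‖ ≤ D * Real.sqrt L → ∀ t ∈ Set.Icc (-T) T,
          HasSum (fun n : ℕ => BBM.dysonTerm L s ε a n t) (Ψ t a) ∧
          ∀ n : ℕ, ‖BBM.dysonTerm L s ε a n t‖ ≤ (1 / 2) ^ n * (D * Real.sqrt L)) := by
  have hs0 : 0 ≤ s := by linarith
  -- The estimates are proved at a regularity in `(1/4, 1/2]`; the remaining `s - σ` derivatives are
  -- distributed over the factors at a cost depending only on `s`.
  set σ : ℝ := min s (1 / 2) with hσdef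
  have hσ : 1 / 4 < σ := lt_min hs (by norm_num)
  have hσ2 : σ ≤ 1 / 2 := min_le_right _ _
  have hσs : σ ≤ s := min_le_left _ _
  set A : ℝ := 2 ^ (2 * (s - σ)) * BBM.schurConst σ with hAdef
  have hA : 0 ≤ A := mul_nonneg (by positivity) (BBM.schurConst_nonneg σ)
  refine ⟨(1392 * (A + 1)) ^ 2, by positivity, ?_⟩
  intro L hL D ε T hL1 hD hε hεC hT
  have hTpos : 0 < T := by
    rw [hT]
    positivity
  have : CompleteSpace (BBM.Hs L s) := BBM.Hs.completeSpace hs0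
  obtain ⟨N, B, hN, hnf⟩ := BBM.exists_normalForm (L := L) hL1 hσ hσ2 hσs hs0 hTpos
  rw [mul_right_comm] at hnf
  have hsm := BBM.small_of_constant hA rfl hL1 hD hε hεC hT
  have hdy := hN.isDyson hs0 ε
  have hsol : ∀ a : BBM.Hs L s, ‖a‖ ≤ D * Real.sqrt L → BBM.SolvesOn (BBM.WCLM L hs0) N ε T a
      fun t => ∑' n, BBM.dysonTerm L s ε a n t := fun a ha => hnf.solvesOn_tsum hsm (hdy a) ha
  refine ⟨fun t a => ∑' n, BBM.dysonTerm L s ε a n t,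
    fun a ha => (hN.isSolution_iff hs0 ε T a _).2 (hsol a ha),
    fun a ha u hu t ht => ((hN.isSolution_iff hs0 ε T a u).1 hu).eqOn hTpos (hsol a ha) ht,
    fun a b ha hb t ht => hnf.norm_tsum_sub_le hsm (hdy a) (hdy b) ha hb ht, ?_,
    fun a ha t ht => hnf.hasSum_tsum hsm (hdy a) ha ht⟩
  intro a ha hreal t ht
  obtain ⟨J, hJ⟩ := BBM.exists_conj (L := L) hs0
  have hJa : J a = a := BBM.Hs.ext_hat fun k => by
    rw [hJ, (BBM.im_eq_zero_iff a).1 hreal k]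
  obtain ⟨h1, h2, h3⟩ := hsol a ha
  -- Conjugation commutes with `W` and `N`, so the conjugate of the solution solves the same problem
  -- with the same real datum, and uniqueness identifies the two.
  have hJsol : BBM.SolvesOn (BBM.WCLM L hs0) N ε T a
      fun t => J (∑' n, BBM.dysonTerm L s ε a n t) := by
    refine ⟨J.continuous.comp_continuousOn h1, (congrArg J h2).trans hJa, fun t ht => ?_⟩
    refine (J.hasFDerivAt.comp_hasDerivWithinAt t (h3 t ht)).congr_deriv ?_
    rw [map_neg, map_add, map_smul, hN.conj_eq hJ, BBM.conj_WCLM hs0 hJ]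
  have h4 := hJsol.eqOn hTpos (hsol a ha) ht
  refine (BBM.im_eq_zero_iff _).2 fun k => ?_
  rw [← hJ]
  exact congrArg (fun u : BBM.Hs L s => BBM.hat L u k) h4.symm
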